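/- Theorem 1.3. Let $f(i)=\log_2(1+i)$ and let $1\le n_1<n_2<\cdots$ be integers with $\sum_{k=1}^\infty 1/f(n_k)<\tfrac1{10}$. On the space $c_{00}$ of finitely supported real sequences put $\|x\|_{(0)}=\|x\|_{c_0}=\max_i|x(i)|$ and $$\|x\|_{(k+1)}=\max\Big\{\|x\|_{(k)},\Big(\sum_{i=1}^\infty\|x\|_{(k,n_i)}^2\Big)^{1/2}\Big\},\qquad \|x\|_{(k,m)}=\max_{E_1<\cdots<E_m}\frac1{f(m)}\sum_{j=1}^m\|E_jx\|_{(k)},$$ where $E_jx$ is the restriction of $x$ to the finite set $E_j\subset\mathbb N$, and let $\|x\|=\lim_k\|x\|_{(k)}$. This is a norm, and it satisfies $$\|x\|=\max\Big\{\|x\|_{c_0},\Big(\sum_{k=1}^\infty\|x\|_{n_k}^2\Big)^{1/2}\Big\},\qquad \|x\|_m=\max_{E_1<\cdots<E_m}\frac1{f(m)}\sum_{j=1}^m\|E_jx\|.$$ Let $X$ be the completion of $(c_{00},\|\cdot\|)$ and $(e_i)$ its unit vector basis. Let $(x_i)$ be a normalized block basis of $(e_i)$, and let $(u_i)$ be a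 spreading model of $(x_i)$, that is, a sequence in a real Banach space such that for all $m$ and all $b_1,\dots,b_m\in\mathbb R$ $$\Big\|\sum_{j=1}^m b_ju_j\Big\|=\lim_{\ell\to\infty,\ \ell<i_1<\cdots<i_m}\Big\|\sum_{j=1}^m b_jx_{i_j}\Big\| .$$ Then the closed linear span $[(u_i)]$ has no subspace isomorphic to $\ell_1$. Moreover $X$ has no subspace isomorphic to $\ell_1$ or to $c_0$, and $X$ is reflexive. -/

import Mathlib

open scoped ENNReal NNReal ZeroAtInfty

noncomputable section

namespace OdellSchlumprecht

/-! ### The norm -/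

/-- `f(i) = log₂ (1 + i)`. -/
def f (i : ℕ) : ℝ := Real.logb 2 (1 + i)

/-- A strictly increasing sequence of positive integers `n 0 < n 1 < ⋯`
with `∑ k, 1 / f (n k) < 1 / 10`. -/
structure SparseSeq where
  n : ℕ → ℕ
  pos : ∀ k, 1 ≤ n k
  strictMono : StrictMono n
  summable : Summable fun k => 1 / f (n k)
  tsum_lt : ∑' k, 1 / f (n k) < 1 / 10

/-- `E 0 < E 1 < ⋯ < E (m-1)`: every element of an earlier set is smaller than every element of a
later one (empty sets, which contribute nothing to the norms below, are allowed). -/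
def Successive {m : ℕ} (E : Fin m → Finset ℕ) : Prop :=
  ∀ i j, i < j → ∀ a ∈ E i, ∀ b ∈ E j, a < b

/-- `Ex`: the restriction of `x ∈ c₀₀` to `E`. -/
def restr (E : Finset ℕ) (x : ℕ →₀ ℝ) : ℕ →₀ ℝ := x.filter (· ∈ E)

/-- `sup_{E_1 < ⋯ < E_m} (1 / f m) ∑ j, N (E_j x)`, for a functional `N` on `c₀₀`. -/
def splitNorm (N : (ℕ →₀ ℝ) → ℝ≥0∞) (m : ℕ) (x : ℕ →₀ ℝ) : ℝ≥0∞ :=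
  ⨆ E : {E : Fin m → Finset ℕ // Successive E},
    ENNReal.ofReal (1 / f m) * ∑ j, N (restr (E.1 j) x)

/-- The `k`-th approximation of the norm: it starts with the sup norm, and
`‖x‖₍ₖ₊₁₎ = max {‖x‖₍ₖ₎, (∑ i, ‖x‖_{(k, n i)}²)^{1/2}}`. -/
def iterNorm (n : ℕ → ℕ) : ℕ → (ℕ →₀ ℝ) → ℝ≥0∞
  | 0, x => ⨆ i, ‖x i‖ₑ
  | k + 1, x =>
      max (iterNorm n k x) ((∑' i, splitNorm (iterNorm n k) (n i) x ^ 2) ^ (1 / 2 : ℝ))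

/-- The limit of the increasing sequence of approximations. -/
def limNorm (n : ℕ → ℕ) (x : ℕ →₀ ℝ) : ℝ≥0∞ := ⨆ k, iterNorm n k x

lemma f_nonneg (i : ℕ) : 0 ≤ f i :=
  Real.logb_nonneg (by norm_num) (by simp)

lemma restr_apply (E : Finset ℕ) (x : ℕ →₀ ℝ) (i : ℕ) :
    restr E x i = if i ∈ E then x i else 0 := by
  classical
  simp [restr, Finsupp.filter_apply]

lemma restr_add (E : Finset ℕ) (x y : ℕ →₀ ℝ) : restr E (x + y) = restr E x + restr E y :=
  Finsupp.filter_add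

lemma restr_smul (E : Finset ℕ) (c : ℝ) (x : ℕ →₀ ℝ) : restr E (c • x) = c • restr E x :=
  Finsupp.filter_smul

lemma sqrt_le_iff (a L : ℝ≥0∞) : a ^ (1 / 2 : ℝ) ≤ L ↔ a ≤ L ^ 2 := by
  rw [one_div, ENNReal.rpow_inv_le_iff (by norm_num)]
  norm_num

lemma ell2_add_le (a b : ℕ → ℝ≥0∞) :
    (∑' i, (a i + b i) ^ 2) ^ (1 / 2 : ℝ) ≤
      (∑' i, a i ^ 2) ^ (1 / 2 : ℝ) + (∑' i, b i ^ 2) ^ (1 / 2 : ℝ) := by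
  rw [sqrt_le_iff, ENNReal.tsum_eq_iSup_sum]
  refine iSup_le fun s => ?_
  rw [← sqrt_le_iff]
  have h := ENNReal.Lp_add_le s a b (p := 2) (by norm_num)
  simp only [ENNReal.rpow_two] at h
  refine h.trans ?_
  gcongr <;> exact ENNReal.sum_le_tsum s

lemma splitNorm_mono {N M : (ℕ →₀ ℝ) → ℝ≥0∞} (h : ∀ x, N x ≤ M x) (m : ℕ) (x : ℕ →₀ ℝ) :
    splitNorm N m x ≤ splitNorm M m x :=
  iSup_mono fun E => by gcongr; exact h _

lemma splitNorm_add_le {N : (ℕ →₀ ℝ) → ℝ≥0∞} (h : ∀ x y, N (x + y) ≤ N x + N y) (m : ℕ)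
    (x y : ℕ →₀ ℝ) : splitNorm N m (x + y) ≤ splitNorm N m x + splitNorm N m y := by
  refine iSup_le fun E => ?_
  calc ENNReal.ofReal (1 / f m) * ∑ j, N (restr (E.1 j) (x + y))
      ≤ ENNReal.ofReal (1 / f m) * ∑ j, (N (restr (E.1 j) x) + N (restr (E.1 j) y)) := by
        gcongr; rw [restr_add]; exact h _ _
    _ = ENNReal.ofReal (1 / f m) * ∑ j, N (restr (E.1 j) x) +
          ENNReal.ofReal (1 / f m) * ∑ j, N (restr (E.1 j) y) := by
        rw [Finset.sum_add_distrib, mul_add]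
    _ ≤ _ := by
        gcongr
        · exact le_iSup (fun E : {E : Fin m → Finset ℕ // Successive E} =>
            ENNReal.ofReal (1 / f m) * ∑ j, N (restr (E.1 j) x)) E
        · exact le_iSup (fun E : {E : Fin m → Finset ℕ // Successive E} =>
            ENNReal.ofReal (1 / f m) * ∑ j, N (restr (E.1 j) y)) E

lemma splitNorm_smul {N : (ℕ →₀ ℝ) → ℝ≥0∞} (h : ∀ (c : ℝ) x, N (c • x) = ‖c‖ₑ * N x) (m : ℕ)
    (c : ℝ) (x : ℕ →₀ ℝ) : splitNorm N m (c • x) = ‖c‖ₑ * splitNorm N m x := by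
  simp only [splitNorm, restr_smul, h, ← Finset.mul_sum, ENNReal.mul_iSup]
  exact iSup_congr fun E => mul_left_comm _ _ _

lemma iterNorm_mono (n : ℕ → ℕ) (x : ℕ →₀ ℝ) : Monotone fun k => iterNorm n k x :=
  monotone_nat_of_le_succ fun _ => le_max_left _ _

lemma iterNorm_add_le (n : ℕ → ℕ) (k : ℕ) (x y : ℕ →₀ ℝ) :
    iterNorm n k (x + y) ≤ iterNorm n k x + iterNorm n k y := by
  induction k generalizing x y with
  | zero =>
    refine iSup_le fun i => ?_
    rw [Finsupp.add_apply]
    exact (enorm_add_le _ _).trans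
      (add_le_add (le_iSup (fun i => ‖x i‖ₑ) i) (le_iSup (fun i => ‖y i‖ₑ) i))
  | succ k ih =>
    refine max_le ((ih x y).trans (add_le_add (le_max_left _ _) (le_max_left _ _))) ?_
    refine le_trans ?_ (add_le_add (le_max_right _ _) (le_max_right _ _))
    refine le_trans ?_ (ell2_add_le _ _)
    gcongr
    exact splitNorm_add_le ih _ _ _

lemma iterNorm_smul (n : ℕ → ℕ) (k : ℕ) (c : ℝ) (x : ℕ →₀ ℝ) :
    iterNorm n k (c • x) = ‖c‖ₑ * iterNorm n k x := by
  induction k generalizing c x with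
  | zero => simp [iterNorm, ENNReal.mul_iSup, enorm_mul]
  | succ k ih =>
    simp only [iterNorm, splitNorm_smul ih, mul_pow, ENNReal.tsum_mul_left, ih]
    rw [ENNReal.mul_rpow_of_nonneg _ _ (by norm_num), ← ENNReal.rpow_natCast, ← ENNReal.rpow_mul,
      mul_max]
    norm_num

lemma splitNorm_ell1_le (m : ℕ) (x : ℕ →₀ ℝ) :
    splitNorm (fun y => ∑' i, ‖y i‖ₑ) m x ≤ ENNReal.ofReal (1 / f m) * ∑' i, ‖x i‖ₑ := by
  refine iSup_le fun E => ?_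
  gcongr
  rw [← Summable.tsum_finsetSum fun _ _ => ENNReal.summable]
  refine ENNReal.tsum_le_tsum fun i => ?_
  simp only [restr_apply]
  by_cases hi : ∃ j, i ∈ E.1 j
  · obtain ⟨j, hj⟩ := hi
    rw [Finset.sum_eq_single j]
    · simp [hj]
    · intro l _ hl
      have : i ∉ E.1 l := fun h => by
        rcases lt_or_gt_of_ne hl with h' | h'
        · exact (E.2 _ _ h' _ h _ hj).false
        · exact (E.2 _ _ h' _ hj _ h).false
      simp [this]
    · simp
  · push Not at hi
    simp [hi]

/-- The approximations are dominated by the `ℓ₁` norm. -/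
lemma iterNorm_le_ell1 (s : SparseSeq) (k : ℕ) (x : ℕ →₀ ℝ) :
    iterNorm s.n k x ≤ ∑' i, ‖x i‖ₑ := by
  induction k generalizing x with
  | zero => exact iSup_le fun i => ENNReal.le_tsum i
  | succ k ih =>
    refine max_le (ih x) ?_
    rw [sqrt_le_iff]
    have hw : ∑' i, ENNReal.ofReal (1 / f (s.n i)) ≤ 1 := by
      rw [← ENNReal.ofReal_tsum_of_nonneg (fun i => one_div_nonneg.2 (f_nonneg _)) s.summable]
      exact ENNReal.ofReal_le_one.2 (by linarith [s.tsum_lt])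
    have h1 : ∀ i, ENNReal.ofReal (1 / f (s.n i)) ≤ 1 := fun i => (ENNReal.le_tsum i).trans hw
    calc ∑' i, splitNorm (iterNorm s.n k) (s.n i) x ^ 2
        ≤ ∑' i, (ENNReal.ofReal (1 / f (s.n i)) * ∑' j, ‖x j‖ₑ) ^ 2 := by
          gcongr with i
          exact (splitNorm_mono ih _ _).trans (splitNorm_ell1_le _ _)
      _ = (∑' i, ENNReal.ofReal (1 / f (s.n i)) ^ 2) * (∑' j, ‖x j‖ₑ) ^ 2 := by
          simp only [mul_pow, ENNReal.tsum_mul_right]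
      _ ≤ 1 * (∑' j, ‖x j‖ₑ) ^ 2 := by
          gcongr
          refine le_trans (ENNReal.tsum_le_tsum fun i => ?_) hw
          rw [sq]
          exact mul_le_of_le_one_right' (h1 i)
      _ = _ := one_mul _

lemma limNorm_ne_top (s : SparseSeq) (x : ℕ →₀ ℝ) : limNorm s.n x ≠ ∞ := by
  refine ne_top_of_le_ne_top ?_ (iSup_le fun k => iterNorm_le_ell1 s k x)
  rw [tsum_eq_sum (s := x.support) (by simp)]
  simp

lemma limNorm_add_le (n : ℕ → ℕ) (x y : ℕ →₀ ℝ) :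
    limNorm n (x + y) ≤ limNorm n x + limNorm n y :=
  iSup_le fun k => (iterNorm_add_le n k x y).trans
    (add_le_add (le_iSup (fun k => iterNorm n k x) k) (le_iSup (fun k => iterNorm n k y) k))

lemma limNorm_smul (n : ℕ → ℕ) (c : ℝ) (x : ℕ →₀ ℝ) :
    limNorm n (c • x) = ‖c‖ₑ * limNorm n x := by
  simp only [limNorm, iterNorm_smul, ENNReal.mul_iSup]

lemma enorm_apply_le_limNorm (n : ℕ → ℕ) (x : ℕ →₀ ℝ) (i : ℕ) : ‖x i‖ₑ ≤ limNorm n x :=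
  (le_iSup (fun i => ‖x i‖ₑ) i).trans (le_iSup (fun k => iterNorm n k x) 0)

/-! ### The space `X` -/

/-- The space `c₀₀` of finitely supported real sequences, to be equipped with the norm `limNorm`. -/
def C00 (_ : SparseSeq) : Type := ℕ →₀ ℝ

variable (s : SparseSeq)

instance : AddCommGroup (C00 s) := inferInstanceAs (AddCommGroup (ℕ →₀ ℝ))

instance : Module ℝ (C00 s) := inferInstanceAs (Module ℝ (ℕ →₀ ℝ))

/-- A finitely supported sequence, as an element of the normed space `C00 s`. -/
def C00.mk (x : ℕ →₀ ℝ) : C00 s := x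

instance : Norm (C00 s) := ⟨fun x => (limNorm s.n x).toReal⟩

lemma C00.norm_mk (x : ℕ →₀ ℝ) : ‖C00.mk s x‖ = (limNorm s.n x).toReal := rfl

lemma C00.normCore : NormedSpace.Core ℝ (C00 s) where
  norm_nonneg _ := ENNReal.toReal_nonneg
  norm_smul c x := by
    have h : ∀ y : ℕ →₀ ℝ, (limNorm s.n (c • y)).toReal = ‖c‖ * (limNorm s.n y).toReal :=
      fun y => by rw [limNorm_smul, ENNReal.toReal_mul, toReal_enorm]
    exact h x
  norm_triangle x y := by
    change (limNorm s.n ((x : ℕ →₀ ℝ) + (y : ℕ →₀ ℝ))).toReal ≤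
      (limNorm s.n x).toReal + (limNorm s.n y).toReal
    rw [← ENNReal.toReal_add (limNorm_ne_top s x) (limNorm_ne_top s y)]
    exact ENNReal.toReal_mono
      (ENNReal.add_ne_top.2 ⟨limNorm_ne_top s x, limNorm_ne_top s y⟩) (limNorm_add_le _ _ _)
  norm_eq_zero_iff x := by
    change (limNorm s.n x).toReal = 0 ↔ x = 0
    rw [ENNReal.toReal_eq_zero_iff, or_iff_left (limNorm_ne_top s x)]
    constructor
    · intro h
      refine Finsupp.ext (f := (x : ℕ →₀ ℝ)) (g := 0) fun i => ?_
      have := enorm_apply_le_limNorm s.n x i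
      rw [h] at this
      simpa using this
    · rintro rfl
      have := limNorm_smul s.n 0 (0 : ℕ →₀ ℝ)
      rw [zero_smul, enorm_zero, zero_mul] at this
      exact this

instance : NormedAddCommGroup (C00 s) := NormedAddCommGroup.ofCore (C00.normCore s)

instance : NormedSpace ℝ (C00 s) := NormedSpace.ofCore (C00.normCore s)

/-- The Banach space `X`: the completion of `c₀₀` under the norm. -/
abbrev X : Type := UniformSpace.Completion (C00 s)

/-- The unit vector basis `(e_i)` of `X`. -/
def X.e (i : ℕ) : X s := ((C00.mk s (Finsupp.single i 1) : C00 s) : X s)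

/-! ### The implicit equation -/

/-- `‖x‖_m = max_{E_1 < ⋯ < E_m} (1 / f m) ∑ j, ‖E_j x‖`, for the norm of `X`. -/
def C00.splitNorm (m : ℕ) (x : ℕ →₀ ℝ) : ℝ :=
  sSup {t | ∃ E : Fin m → Finset ℕ, Successive E ∧
    t = 1 / f m * ∑ j, ‖C00.mk s (restr (E j) x)‖}

/-- The supremum in `C00.splitNorm` is a maximum. -/
theorem C00.isGreatest_splitNorm (m : ℕ) (x : ℕ →₀ ℝ) :
    IsGreatest {t | ∃ E : Fin m → Finset ℕ, Successive E ∧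
      t = 1 / f m * ∑ j, ‖C00.mk s (restr (E j) x)‖} (C00.splitNorm s m x) := by
  classical
  have hfin : {t | ∃ E : Fin m → Finset ℕ, Successive E ∧
      t = 1 / f m * ∑ j, ‖C00.mk s (restr (E j) x)‖}.Finite := by
    refine (Set.finite_range fun E : Fin m → {F // F ∈ x.support.powerset} =>
      1 / f m * ∑ j, ‖C00.mk s (restr (E j).1 x)‖).subset ?_
    rintro t ⟨E, _, rfl⟩
    refine ⟨fun j => ⟨E j ∩ x.support, by simp⟩, ?_⟩
    have : ∀ j, restr (E j ∩ x.support) x = restr (E j) x := fun j => by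
      ext i
      simp only [restr_apply, Finset.mem_inter, Finsupp.mem_support_iff]
      by_cases h : x i = 0 <;> simp [h]
    simp [this]
  have hne : {t | ∃ E : Fin m → Finset ℕ, Successive E ∧
      t = 1 / f m * ∑ j, ‖C00.mk s (restr (E j) x)‖}.Nonempty :=
    ⟨_, fun _ => ∅, by simp [Successive], rfl⟩
  exact ⟨hne.csSup_mem hfin, fun t ht => le_csSup hfin.bddAbove ht⟩

lemma C00.ofReal_splitNorm (m : ℕ) (x : ℕ →₀ ℝ) :
    ENNReal.ofReal (C00.splitNorm s m x) =
      OdellSchlumprecht.splitNorm (limNorm s.n) m x := by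
  have key : ∀ E : Fin m → Finset ℕ,
      ENNReal.ofReal (1 / f m * ∑ j, ‖C00.mk s (restr (E j) x)‖) =
        ENNReal.ofReal (1 / f m) * ∑ j, limNorm s.n (restr (E j) x) := fun E => by
    rw [ENNReal.ofReal_mul (one_div_nonneg.2 (f_nonneg m)),
      ENNReal.ofReal_sum_of_nonneg fun _ _ => norm_nonneg _]
    simp only [C00.norm_mk, ENNReal.ofReal_toReal (limNorm_ne_top s _)]
  obtain ⟨⟨E, hE, h⟩, hmax⟩ := C00.isGreatest_splitNorm s m x
  apply le_antisymm
  · rw [h, key]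
    exact le_iSup (fun E : {E : Fin m → Finset ℕ // Successive E} =>
      ENNReal.ofReal (1 / f m) * ∑ j, limNorm s.n (restr (E.1 j) x)) ⟨E, hE⟩
  · refine iSup_le fun E => ?_
    rw [← key]
    exact ENNReal.ofReal_le_ofReal (hmax ⟨E.1, E.2, rfl⟩)

lemma limNorm_eq (n : ℕ → ℕ) (x : ℕ →₀ ℝ) :
    limNorm n x =
      max (⨆ i, ‖x i‖ₑ) ((∑' i, splitNorm (limNorm n) (n i) x ^ 2) ^ (1 / 2 : ℝ)) := by
  have hle : ∀ k y, iterNorm n k y ≤ limNorm n y := fun k y =>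
    le_iSup (fun k => iterNorm n k y) k
  apply le_antisymm
  · refine iSup_le fun k => ?_
    induction k with
    | zero => exact le_max_left _ _
    | succ k ih =>
      refine max_le ih (le_trans ?_ (le_max_right _ _))
      gcongr
      exact splitNorm_mono (hle k) _ _
  · refine max_le (hle 0 x) ?_
    rw [sqrt_le_iff]
    have h1 : ∀ m, splitNorm (limNorm n) m x = ⨆ k, splitNorm (iterNorm n k) m x := fun m => by
      simp only [splitNorm, limNorm]
      rw [iSup_comm]
      refine iSup_congr fun E => ?_
      rw [ENNReal.finsetSum_iSup_of_monotone fun j => iterNorm_mono n _, ENNReal.mul_iSup]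
    rw [ENNReal.tsum_eq_iSup_sum]
    refine iSup_le fun t => ?_
    simp only [h1, ENNReal.iSup_pow]
    rw [ENNReal.finsetSum_iSup_of_monotone fun j a b hab => by
      gcongr
      exact splitNorm_mono (fun y => iterNorm_mono n y hab) _ _]
    refine iSup_le fun k => (ENNReal.sum_le_tsum t).trans ?_
    rw [← sqrt_le_iff]
    exact (le_max_right _ _).trans (hle (k + 1) x)

/-- The norm of `X` satisfies the implicit equation
`‖x‖ = max {‖x‖_{c₀}, (∑ k, ‖x‖_{n k}²)^{1/2}}` on `c₀₀`. -/
theorem C00.norm_eq (x : ℕ →₀ ℝ) :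
    Summable (fun k => C00.splitNorm s (s.n k) x ^ 2) ∧
    ‖C00.mk s x‖ = max (⨆ i, |x i|) (√(∑' k, C00.splitNorm s (s.n k) x ^ 2)) := by
  have h0 : ∀ m, 0 ≤ C00.splitNorm s m x := fun m =>
    le_trans (mul_nonneg (one_div_nonneg.2 (f_nonneg m))
      (Finset.sum_nonneg fun j _ => norm_nonneg _))
      ((C00.isGreatest_splitNorm s m x).2 ⟨fun _ => ∅, by simp [Successive], rfl⟩)
  have hsq : ∀ k, OdellSchlumprecht.splitNorm (limNorm s.n) (s.n k) x ^ 2 =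
      ENNReal.ofReal (C00.splitNorm s (s.n k) x ^ 2) := fun k => by
    rw [← C00.ofReal_splitNorm, ENNReal.ofReal_pow (h0 _)]
  have heq := limNorm_eq s.n x
  have htop : (∑' k, ENNReal.ofReal (C00.splitNorm s (s.n k) x ^ 2)) ≠ ∞ := by
    simp only [← hsq]
    refine ne_top_of_le_ne_top (ENNReal.pow_ne_top (limNorm_ne_top s x) (n := 2)) ?_
    rw [← sqrt_le_iff]
    exact (le_max_right _ _).trans heq.ge
  have hsum : Summable (fun k => C00.splitNorm s (s.n k) x ^ 2) := by
    have := ENNReal.summable_toReal htop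
    simpa only [ENNReal.toReal_ofReal (sq_nonneg _)] using this
  refine ⟨hsum, ?_⟩
  have hsup : (⨆ i, ‖x i‖ₑ) ≠ ∞ :=
    ne_top_of_le_ne_top (limNorm_ne_top s x) ((le_max_left _ _).trans heq.ge)
  rw [C00.norm_mk, heq]
  simp only [hsq]
  rw [ENNReal.toReal_max hsup (ENNReal.rpow_ne_top_of_nonneg (by norm_num) htop),
    ENNReal.toReal_iSup fun i => enorm_ne_top, ← ENNReal.toReal_rpow,
    ← ENNReal.ofReal_tsum_of_nonneg (fun _ => sq_nonneg _) hsum,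
    ENNReal.toReal_ofReal (tsum_nonneg fun _ => sq_nonneg _), ← Real.sqrt_eq_rpow]
  simp

/-! ### Block bases, spreading models, subspaces, reflexivity -/

/-- `(x i)` is a normalized block basis of `(e j)`: there are `p 0 < p 1 < ⋯` such that each `x i`
is a linear combination of norm one of the vectors `e j`, `p i ≤ j < p (i + 1)`. -/
def IsNormalizedBlockBasis {E : Type*} [NormedAddCommGroup E] [NormedSpace ℝ E]
    (e : ℕ → E) (x : ℕ → E) : Prop :=
  ∃ p : ℕ → ℕ, StrictMono p ∧ ∃ a : ℕ → ℝ,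
    ∀ i, x i = ∑ j ∈ Finset.Ico (p i) (p (i + 1)), a j • e j ∧ ‖x i‖ = 1

/-- `(u i)` is a spreading model of `(x i)`: for all scalars `b 0, …, b (m-1)`,
`‖∑ j, b j • u j‖` is the limit of `‖∑ j, b j • x (i j)‖` as `ℓ → ∞`, `ℓ < i 0 < ⋯ < i (m-1)`. -/
def IsSpreadingModel {E F : Type*} [NormedAddCommGroup E] [NormedSpace ℝ E]
    [NormedAddCommGroup F] [NormedSpace ℝ F] (x : ℕ → E) (u : ℕ → F) : Prop :=
  ∀ (m : ℕ) (b : Fin m → ℝ), ∀ ε > 0, ∃ ℓ : ℕ, ∀ i : Fin m → ℕ, StrictMono i →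
    (∀ j, ℓ < i j) → |‖∑ j, b j • x (i j)‖ - ‖∑ j : Fin m, b j • u j‖| < ε

/-- `[(u i)]`: the closed linear span of a sequence. -/
def closedSpan {F : Type*} [NormedAddCommGroup F] [NormedSpace ℝ F] (u : ℕ → F) :
    Submodule ℝ F :=
  (Submodule.span ℝ (Set.range u)).topologicalClosure

/-- `F` contains `E`: `E` is linearly isomorphic to a subspace of `F`. -/
def Contains (F E : Type*) [NormedAddCommGroup F] [NormedSpace ℝ F]
    [NormedAddCommGroup E] [NormedSpace ℝ E] : Prop :=
  ∃ T : E →L[ℝ] F, ∃ c > 0, ∀ x, c * ‖x‖ ≤ ‖T x‖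

/-- The real sequence space `ℓ₁`. -/
abbrev Ell1 : Type := lp (fun _ : ℕ => ℝ) 1

/-- The space `c₀` of real null sequences with the sup norm. -/
abbrev CZero : Type := C₀(ℕ, ℝ)

/-- Reflexivity: the canonical map into the bidual is onto. -/
def IsReflexive (E : Type*) [NormedAddCommGroup E] [NormedSpace ℝ E] : Prop :=
  Function.Surjective (NormedSpace.inclusionInDoubleDual ℝ E)

end OdellSchlumprecht

end

open OdellSchlumprecht

open scoped ENNReal NNReal ZeroAtInfty

noncomputable section

namespace OdellSchlumprecht

open Filter Topology

/-! ### Successive sequences in `c₀₀` -/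

/-! Everything is reduced to successive vectors ("blocks") of c₀₀, where two estimates pull in
opposite directions.

Lower estimate (`sum_norm_le`): the sum of `n_k` blocks has norm at least `1 / f(n_k)` times the sum
of their norms. Since `n / f(n)` is unbounded, seminormalized blocks never have bounded partial sums
(`not_bounded_sums`); this excludes c₀.

Against ℓ₁ (`not_almost_isometric_ell1`): above the sup norm, the norm of `X` is the ℓ₂ norm of the
component sequence `(‖x‖_{n_k})_k`. If disjointly supported `x`, `y` in the unit ball have `‖x + y‖`
almost 2, uniform convexity of ℓ₂ makes their component sequences close, so an index `K` beyond
which `x` has little mass also serves for `y` (`tail_comp_sq_le`). Hence one `K` serves a whole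
almost isometric ℓ₁ sequence. But in a sum of `m > n_K` such blocks, each component with `k < K` is
at most `2m / f(n_k)`, which is small in total because `∑ 1 / f(n_k) < 1/10`, while the tails
contribute at most half of `m²` to the square of the norm. So the norm is below `0.99 m`
(`exists_norm_sum_lt`), a contradiction. James' distortion argument upgrades any lower ℓ₁ estimate
on blocks to an almost isometric one. A finite combination in a spreading model is approximated by
the same combination of far out `x_i`, so the contradiction reaches spreading models too.

A gliding hump on differences of basis vectors turns a copy of ℓ₁ or c₀ into blocks. For
reflexivity, the ℓ₁ statement makes the basis shrinking, the statement on partial sums makes it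
boundedly complete, and James' classical argument concludes. -/

/-- A sequence of successively supported vectors. -/
def IsBlock (w : ℕ → ℕ →₀ ℝ) : Prop :=
  ∀ i j, i < j → ∀ a ∈ (w i).support, ∀ b ∈ (w j).support, a < b

lemma IsBlock.sum_apply {w : ℕ → ℕ →₀ ℝ} (hw : IsBlock w) {G : Finset ℕ} {i a : ℕ} (hi : i ∈ G)
    (hia : w i a ≠ 0) : (∑ j ∈ G, w j) a = w i a := by
  rw [Finsupp.finsetSum_apply]
  refine Finset.sum_eq_single_of_mem i hi fun j _ hj => ?_
  by_contra hja
  rcases lt_or_gt_of_ne hj with h | h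
  · exact (hw _ _ h a (Finsupp.mem_support_iff.2 hja) a (Finsupp.mem_support_iff.2 hia)).false
  · exact (hw _ _ h a (Finsupp.mem_support_iff.2 hia) a (Finsupp.mem_support_iff.2 hja)).false

lemma restr_comm (E G : Finset ℕ) (x : ℕ →₀ ℝ) : restr E (restr G x) = restr G (restr E x) := by
  ext i
  simp only [restr_apply]
  split_ifs <;> rfl

lemma restr_sum (E : Finset ℕ) {ι : Type*} (t : Finset ι) (x : ι → ℕ →₀ ℝ) :
    restr E (∑ i ∈ t, x i) = ∑ i ∈ t, restr E (x i) := by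
  classical
  induction t using Finset.induction_on with
  | empty => ext i; simp [restr_apply]
  | insert a t ha ih => rw [Finset.sum_insert ha, Finset.sum_insert ha, restr_add, ih]

lemma restr_eq_self {E : Finset ℕ} {x : ℕ →₀ ℝ} (h : x.support ⊆ E) : restr E x = x := by
  ext i
  rw [restr_apply, ite_eq_left_iff]
  exact fun hi => (Finsupp.notMem_support_iff.1 fun h' => hi (h h')).symm

lemma restr_eq_zero {E : Finset ℕ} {x : ℕ →₀ ℝ} (h : ∀ i ∈ E, i ∉ x.support) :
    restr E x = 0 := by
  ext i
  rw [restr_apply, Finsupp.zero_apply, ite_eq_right_iff]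
  exact fun hi => Finsupp.notMem_support_iff.1 (h i hi)

lemma support_restr (E : Finset ℕ) (x : ℕ →₀ ℝ) : (restr E x).support ⊆ E ∩ x.support := by
  intro i hi
  rw [Finsupp.mem_support_iff, restr_apply] at hi
  simp only [Finset.mem_inter, Finsupp.mem_support_iff]
  constructor <;> by_contra h <;> simp_all

/-- Induction on `k`, since restrictions commute. In the limit, restriction to any finite set is a
contraction of `X`. -/
lemma iterNorm_restr_le (n : ℕ → ℕ) (k : ℕ) (E : Finset ℕ) (x : ℕ →₀ ℝ) :
    iterNorm n k (restr E x) ≤ iterNorm n k x := by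
  induction k generalizing x with
  | zero =>
    refine iSup_mono fun i => ?_
    rw [restr_apply]
    split_ifs <;> simp
  | succ k ih =>
    refine max_le_max (ih x) ?_
    gcongr with i
    refine iSup_mono fun G => ?_
    gcongr with j
    rw [restr_comm]
    exact ih _

/-! ### The norm of `X` on `c₀₀` -/

variable (s : SparseSeq)

/-- The embedding of `c₀₀` into `X`. -/
def toX : (ℕ →₀ ℝ) →ₗ[ℝ] X s :=
  (UniformSpace.Completion.toComplL (𝕜 := ℝ) (E := C00 s)).toLinearMap ∘ₗ
    (LinearMap.id : (ℕ →₀ ℝ) →ₗ[ℝ] (ℕ →₀ ℝ))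

lemma toX_apply (x : ℕ →₀ ℝ) : toX s x = ((C00.mk s x : C00 s) : X s) := rfl

lemma norm_toX (x : ℕ →₀ ℝ) : ‖toX s x‖ = ‖C00.mk s x‖ := by
  rw [toX_apply, UniformSpace.Completion.norm_coe]

lemma denseRange_toX : DenseRange (toX s) :=
  UniformSpace.Completion.denseRange_coe (α := C00 s)

lemma toX_single (i : ℕ) (c : ℝ) : toX s (Finsupp.single i c) = c • X.e s i := by
  have h : X.e s i = toX s (Finsupp.single i 1) := rfl
  rw [h, ← map_smul, Finsupp.smul_single, smul_eq_mul, mul_one]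

lemma norm_toX_restr_le (E : Finset ℕ) (x : ℕ →₀ ℝ) : ‖toX s (restr E x)‖ ≤ ‖toX s x‖ := by
  rw [norm_toX, norm_toX, C00.norm_mk, C00.norm_mk]
  exact ENNReal.toReal_mono (limNorm_ne_top s x) (iSup_mono fun k => iterNorm_restr_le _ _ _ _)

lemma abs_apply_le_norm_toX (x : ℕ →₀ ℝ) (i : ℕ) : |x i| ≤ ‖toX s x‖ := by
  rw [norm_toX, C00.norm_mk, ← Real.norm_eq_abs, ← toReal_enorm]
  exact ENNReal.toReal_mono (limNorm_ne_top s x) (enorm_apply_le_limNorm _ _ _)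

lemma norm_e (i : ℕ) : ‖X.e s i‖ = 1 := by
  have h : X.e s i = toX s (Finsupp.single i 1) := rfl
  apply le_antisymm
  · rw [h, norm_toX, C00.norm_mk, ← ENNReal.toReal_one]
    refine ENNReal.toReal_mono ENNReal.one_ne_top (iSup_le fun k => ?_)
    refine (iterNorm_le_ell1 s k _).trans ?_
    rw [tsum_eq_single i fun j hj => by simp [hj.symm]]
    simp
  · have := abs_apply_le_norm_toX s (Finsupp.single i 1) i
    rw [h]
    simpa using this

/-- The components `‖x‖_{n k}` of the norm. -/
def comp (k : ℕ) (x : ℕ →₀ ℝ) : ℝ := C00.splitNorm s (s.n k) x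

lemma comp_nonneg (k : ℕ) (x : ℕ →₀ ℝ) : 0 ≤ comp s k x :=
  le_trans (mul_nonneg (one_div_nonneg.2 (f_nonneg _))
    (Finset.sum_nonneg fun j _ => norm_nonneg _))
    ((C00.isGreatest_splitNorm s _ x).2 ⟨fun _ => ∅, by simp [Successive], rfl⟩)

lemma le_comp (k : ℕ) (x : ℕ →₀ ℝ) (E : Fin (s.n k) → Finset ℕ) (hE : Successive E) :
    1 / f (s.n k) * ∑ j, ‖toX s (restr (E j) x)‖ ≤ comp s k x := by
  simp only [norm_toX]
  exact (C00.isGreatest_splitNorm s _ x).2 ⟨E, hE, rfl⟩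

lemma exists_comp_eq (k : ℕ) (x : ℕ →₀ ℝ) : ∃ E : Fin (s.n k) → Finset ℕ, Successive E ∧
    comp s k x = 1 / f (s.n k) * ∑ j, ‖toX s (restr (E j) x)‖ := by
  simp only [norm_toX]
  exact (C00.isGreatest_splitNorm s _ x).1

lemma comp_add_le (k : ℕ) (x y : ℕ →₀ ℝ) : comp s k (x + y) ≤ comp s k x + comp s k y := by
  obtain ⟨E, hE, h⟩ := exists_comp_eq s k (x + y)
  refine le_trans ?_ (add_le_add (le_comp s k x E hE) (le_comp s k y E hE))
  rw [h, ← mul_add, ← Finset.sum_add_distrib]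
  gcongr
  · exact one_div_nonneg.2 (f_nonneg _)
  · rw [restr_add, map_add]
    exact norm_add_le _ _

lemma comp_sum_le (k m : ℕ) (x : ℕ → ℕ →₀ ℝ) :
    comp s k (∑ i ∈ Finset.range m, x i) ≤ ∑ i ∈ Finset.range m, comp s k (x i) := by
  induction m with
  | zero =>
    obtain ⟨E, hE, h⟩ := exists_comp_eq s k 0
    have : ∀ G : Finset ℕ, restr G 0 = 0 := fun G => restr_eq_zero (by simp)
    simp [h, this]
  | succ m ih =>
    rw [Finset.sum_range_succ, Finset.sum_range_succ]
    exact (comp_add_le s k _ _).trans (by gcongr)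

lemma summable_comp_sq (x : ℕ →₀ ℝ) : Summable fun k => comp s k x ^ 2 := (C00.norm_eq s x).1

lemma norm_toX_eq (x : ℕ →₀ ℝ) :
    ‖toX s x‖ = max (⨆ i, |x i|) (√(∑' k, comp s k x ^ 2)) := by
  rw [norm_toX]
  exact (C00.norm_eq s x).2

lemma tsum_comp_sq_le (x : ℕ →₀ ℝ) : ∑' k, comp s k x ^ 2 ≤ ‖toX s x‖ ^ 2 := by
  rw [← Real.sqrt_le_left (norm_nonneg _), norm_toX_eq]
  exact le_max_right _ _

lemma comp_le_norm (k : ℕ) (x : ℕ →₀ ℝ) : comp s k x ≤ ‖toX s x‖ :=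
  le_of_sq_le_sq (((summable_comp_sq s x).le_tsum k fun _ _ => sq_nonneg _).trans
    (tsum_comp_sq_le s x)) (norm_nonneg _)

/-- Once the norm exceeds the sup norm, the maximum in the implicit equation is the ℓ₂ term; this
opens the way to Hilbert space arguments. -/
lemma norm_sq_eq_of_lt {x : ℕ →₀ ℝ} {B : ℝ} (hB : ∀ i, |x i| ≤ B) (h : B < ‖toX s x‖) :
    ‖toX s x‖ ^ 2 = ∑' k, comp s k x ^ 2 := by
  have hsup : ⨆ i, |x i| ≤ B := ciSup_le hB
  have := norm_toX_eq s x
  rcases max_choice (⨆ i, |x i|) (√(∑' k, comp s k x ^ 2)) with h' | h'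
  · rw [this, h'] at h
    exact absurd h (not_lt.2 hsup)
  · rw [this, h', Real.sq_sqrt (tsum_nonneg fun _ => sq_nonneg _)]

/-! ### Sums of blocks and the failure of almost isometric ℓ₁. -/

lemma one_div_f_le (k : ℕ) : 1 / f (s.n k) ≤ 1 / 10 :=
  (s.summable.le_tsum k fun _ _ => one_div_nonneg.2 (f_nonneg _)).trans s.tsum_lt.le

/-- The lower estimate for sums of blocks. -/
lemma sum_norm_le (k : ℕ) {w : ℕ → ℕ →₀ ℝ} (hw : IsBlock w) :
    1 / f (s.n k) * ∑ i ∈ Finset.range (s.n k), ‖toX s (w i)‖ ≤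
      ‖toX s (∑ i ∈ Finset.range (s.n k), w i)‖ := by
  refine le_trans ?_ (comp_le_norm s k _)
  refine le_trans (le_of_eq ?_) (le_comp s k _ (fun j => (w j).support)
    fun i j hij a ha b hb => hw i j hij a ha b hb)
  rw [Finset.sum_range]
  congr 1
  refine Finset.sum_congr rfl fun j _ => ?_
  rw [restr_sum, Finset.sum_eq_single (j : ℕ)]
  · rw [restr_eq_self subset_rfl]
  · intro i _ hij
    refine restr_eq_zero fun a ha ha' => ?_
    rcases lt_or_gt_of_ne hij with h | h
    · exact (hw _ _ h a ha' a ha).false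
    · exact (hw _ _ h a ha a ha').false
  · intro h
    exact absurd (Finset.mem_range.2 j.2) h

/-- The upper estimate for sums of many blocks. -/
lemma comp_sum_le_of_block (k m : ℕ) {w : ℕ → ℕ →₀ ℝ} (hw : IsBlock w)
    (h1 : ∀ i < m, ‖toX s (w i)‖ ≤ 1) :
    comp s k (∑ i ∈ Finset.range m, w i) ≤ 1 / f (s.n k) * (m + s.n k) := by
  classical
  obtain ⟨E, hE, h⟩ := exists_comp_eq s k (∑ i ∈ Finset.range m, w i)
  rw [h]
  refine mul_le_mul_of_nonneg_left ?_ (one_div_nonneg.2 (f_nonneg _))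
  -- Only the pairs in `P` contribute, each at most 1, so it suffices to count them.
  let P : Finset (Fin (s.n k) × ℕ) := (Finset.univ ×ˢ Finset.range m).filter
    fun p => restr (E p.1) (w p.2) ≠ 0
  have hne : ∀ p ∈ P, ∃ a ∈ E p.1, a ∈ (w p.2).support := by
    intro p hp
    by_contra! hcon
    exact (Finset.mem_filter.1 hp).2 (restr_eq_zero hcon)
  have hle : ∑ j, ‖toX s (restr (E j) (∑ i ∈ Finset.range m, w i))‖ ≤ P.card := by
    calc ∑ j, ‖toX s (restr (E j) (∑ i ∈ Finset.range m, w i))‖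
        ≤ ∑ j, ∑ i ∈ Finset.range m, ‖toX s (restr (E j) (w i))‖ := by
          gcongr with j
          rw [restr_sum, map_sum]
          exact norm_sum_le _ _
      _ = ∑ p ∈ Finset.univ ×ˢ Finset.range m, ‖toX s (restr (E p.1) (w p.2))‖ := by
          rw [Finset.sum_product]
      _ = ∑ p ∈ P, ‖toX s (restr (E p.1) (w p.2))‖ := by
          refine (Finset.sum_filter_of_ne (p := fun p : Fin (s.n k) × ℕ =>
            restr (E p.1) (w p.2) ≠ 0) fun p _ hp h0 => hp ?_).symm
          rw [h0, map_zero, norm_zero]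
      _ ≤ ∑ p ∈ P, 1 := by
          refine Finset.sum_le_sum fun p hp => ?_
          have hp2 := (Finset.mem_product.1 (Finset.mem_filter.1 hp).1).2
          exact (norm_toX_restr_le s _ _).trans (h1 _ (Finset.mem_range.1 hp2))
      _ = P.card := by simp
  have hcard : P.card ≤ m + s.n k := by
    rw [← Finset.card_range (m + s.n k)]
    -- Both families are successive, so `P` is a monotone staircase in the grid: it meets each
    -- antidiagonal at most once.
    refine Finset.card_le_card_of_injOn (fun p => p.2 + p.1) ?_ ?_
    · intro p hp
      have hp2 := (Finset.mem_product.1 (Finset.mem_filter.1 hp).1).2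
      have := p.1.2
      simp only [Finset.mem_range, Finset.coe_range, Set.mem_Iio] at hp2 ⊢
      omega
    · intro p hp q hq hpq
      obtain ⟨a, ha, ha'⟩ := hne p hp
      obtain ⟨b, hb, hb'⟩ := hne q hq
      obtain ⟨p1, p2⟩ := p
      obtain ⟨q1, q2⟩ := q
      dsimp only at *
      rcases lt_trichotomy p2 q2 with h | h | h
      · have h2 : q1 < p1 := by rw [Fin.lt_def]; omega
        exact absurd (hw _ _ h a ha' b hb') (hE _ _ h2 b hb a ha).not_gt
      · have h2 : p1 = q1 := by rw [Fin.ext_iff]; omega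
        rw [h, h2]
      · have h2 : p1 < q1 := by rw [Fin.lt_def]; omega
        exact absurd (hw _ _ h b hb' a ha') (hE _ _ h2 a ha b hb).not_gt
  exact hle.trans (by exact_mod_cast hcard)

/-- If two disjointly supported vectors of the unit ball have a sum of norm almost `2`, then the
tails of their components are comparable. -/
lemma tail_comp_sq_le {x y : ℕ →₀ ℝ} (hd : ∀ i, x i = 0 ∨ y i = 0) (hx : ‖toX s x‖ ≤ 1)
    (hy : ‖toX s y‖ ≤ 1) (hxy : 99 / 50 ≤ ‖toX s (x + y)‖) (K : ℕ) :
    ∑' k, comp s (k + K) y ^ 2 ≤ 2 * ∑' k, comp s (k + K) x ^ 2 + 16 / 100 := by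
  have hB : ∀ i, |(x + y) i| ≤ 1 := fun i => by
    rcases hd i with h | h
    · rw [Finsupp.add_apply, h, zero_add]; exact (abs_apply_le_norm_toX s y i).trans hy
    · rw [Finsupp.add_apply, h, add_zero]; exact (abs_apply_le_norm_toX s x i).trans hx
  have heq := norm_sq_eq_of_lt s hB (by linarith)
  have hsx := summable_comp_sq s x
  have hsy := summable_comp_sq s y
  have hx2 : ∑' k, comp s k x ^ 2 ≤ 1 :=
    (tsum_comp_sq_le s x).trans (pow_le_one₀ (norm_nonneg _) hx)
  have hy2 : ∑' k, comp s k y ^ 2 ≤ 1 :=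
    (tsum_comp_sq_le s y).trans (pow_le_one₀ (norm_nonneg _) hy)
  -- Parallelogram identity, with `comp s k (x + y)` below the sum of the two components. Summed
  -- over `k`, the right side is at most `4 - 1.98² < 0.08`.
  have hpt : ∀ k, (comp s k x - comp s k y) ^ 2 ≤
      2 * comp s k x ^ 2 + 2 * comp s k y ^ 2 - comp s k (x + y) ^ 2 := fun k => by
    have h1 := comp_add_le s k x y
    have h0 := comp_nonneg s k (x + y)
    nlinarith
  have hsR : Summable fun k => 2 * comp s k x ^ 2 + 2 * comp s k y ^ 2 - comp s k (x + y) ^ 2 :=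
    ((hsx.mul_left 2).add (hsy.mul_left 2)).sub (summable_comp_sq s _)
  have hsd : Summable fun k => (comp s k x - comp s k y) ^ 2 :=
    hsR.of_nonneg_of_le (fun _ => sq_nonneg _) hpt
  have hdiff : ∑' k, (comp s k x - comp s k y) ^ 2 ≤ 8 / 100 := by
    have h := hsd.tsum_le_tsum hpt hsR
    rw [((hsx.mul_left 2).add (hsy.mul_left 2)).tsum_sub (summable_comp_sq s _),
      (hsx.mul_left 2).tsum_add (hsy.mul_left 2), tsum_mul_left, tsum_mul_left, ← heq] at h
    nlinarith
  have htail : ∑' k, (comp s (k + K) x - comp s (k + K) y) ^ 2 ≤ 8 / 100 := by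
    refine le_trans ?_ hdiff
    rw [← hsd.sum_add_tsum_nat_add K]
    exact le_add_of_nonneg_left (Finset.sum_nonneg fun _ _ => sq_nonneg _)
  have h1 := (summable_nat_add_iff K).2 hsx
  have h2 := (summable_nat_add_iff K).2 hsy
  have h3 := (summable_nat_add_iff K).2 hsd
  have hfin : ∑' k, comp s (k + K) y ^ 2 ≤
      ∑' k, (2 * comp s (k + K) x ^ 2 + 2 * (comp s (k + K) x - comp s (k + K) y) ^ 2) :=
    h2.tsum_le_tsum (fun k => by
      nlinarith [sq_nonneg (2 * comp s (k + K) x - comp s (k + K) y)])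
      ((h1.mul_left 2).add (h3.mul_left 2))
  rw [(h1.mul_left 2).tsum_add (h3.mul_left 2), tsum_mul_left, tsum_mul_left] at hfin
  linarith

/-- Averages of many blocks with uniformly small tails have norm well below `1`. -/
lemma exists_norm_sum_lt (K : ℕ) {τ : ℝ} (hτ : τ ≤ 1 / 2) : ∃ m : ℕ, 1 ≤ m ∧
    ∀ w : ℕ → ℕ →₀ ℝ, IsBlock w → (∀ i < m, ‖toX s (w i)‖ ≤ 1) →
      (∀ i < m, ∑' k, comp s (k + K) (w i) ^ 2 ≤ τ) →
      ‖toX s (∑ i ∈ Finset.range m, w i)‖ < 99 / 100 * m := by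
  -- This `m` exceeds every `n_k` with `k < K`, and `m ≥ 2` puts `0.99 m` above the sup norm of the
  -- sum.
  refine ⟨s.n K + 1, by omega, fun w hw h1 hτw => ?_⟩
  set m := s.n K + 1 with hm
  have hm2 : (2 : ℝ) ≤ m := by
    have := s.pos K
    exact_mod_cast (by omega : 2 ≤ m)
  set z := ∑ i ∈ Finset.range m, w i with hz
  by_contra! hcon
  have hB : ∀ a, |z a| ≤ 1 := fun a => by
    by_cases h : ∃ i ∈ Finset.range m, w i a ≠ 0
    · obtain ⟨i, hi, hia⟩ := h
      have : z a = w i a := hw.sum_apply hi hia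
      rw [this]
      exact (abs_apply_le_norm_toX s _ a).trans (h1 i (Finset.mem_range.1 hi))
    · push Not at h
      rw [hz, Finsupp.finsetSum_apply, Finset.sum_eq_zero h]
      simp
  have heq := norm_sq_eq_of_lt s hB (by linarith)
  have hsz := summable_comp_sq s z
  have hhead : ∑ k ∈ Finset.range K, comp s k z ^ 2 ≤ 4 / 100 * (m : ℝ) ^ 2 := by
    have hk : ∀ k ∈ Finset.range K, comp s k z ^ 2 ≤ 4 / 10 * (m : ℝ) ^ 2 * (1 / f (s.n k)) := by
      intro k hk
      have h := comp_sum_le_of_block s k m hw h1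
      have hf := one_div_f_le s k
      have hf0 := one_div_nonneg.2 (f_nonneg (s.n k))
      have hnk : (s.n k : ℝ) ≤ m := by
        have := s.strictMono (Finset.mem_range.1 hk)
        exact_mod_cast (by omega : s.n k ≤ m)
      have h2 : comp s k z ≤ 1 / f (s.n k) * (2 * m) :=
        h.trans (mul_le_mul_of_nonneg_left (by linarith) hf0)
      calc comp s k z ^ 2 ≤ (1 / f (s.n k) * (2 * m)) ^ 2 :=
            pow_le_pow_left₀ (comp_nonneg s k z) h2 2
        _ = 4 * (m : ℝ) ^ 2 * (1 / f (s.n k)) * (1 / f (s.n k)) := by ring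
        _ ≤ 4 * (m : ℝ) ^ 2 * (1 / f (s.n k)) * (1 / 10) :=
            mul_le_mul_of_nonneg_left hf (by positivity)
        _ = _ := by ring
    have hsum : ∑ k ∈ Finset.range K, 1 / f (s.n k) ≤ 1 / 10 :=
      (s.summable.sum_le_tsum _ fun _ _ => one_div_nonneg.2 (f_nonneg _)).trans s.tsum_lt.le
    calc _ ≤ _ := Finset.sum_le_sum hk
      _ = 4 / 10 * (m : ℝ) ^ 2 * ∑ k ∈ Finset.range K, 1 / f (s.n k) := by rw [Finset.mul_sum]
      _ ≤ 4 / 10 * (m : ℝ) ^ 2 * (1 / 10) := mul_le_mul_of_nonneg_left hsum (by positivity)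
      _ = _ := by ring
  -- Subadditivity of each component, then Cauchy–Schwarz over the `m` blocks.
  have htail : ∑' k, comp s (k + K) z ^ 2 ≤ m * (m * τ) := by
    have hsi : ∀ i, Summable fun k => comp s (k + K) (w i) ^ 2 := fun i =>
      (summable_nat_add_iff (f := fun k => comp s k (w i) ^ 2) K).2 (summable_comp_sq s _)
    have hS : Summable fun k => (m : ℝ) * ∑ i ∈ Finset.range m, comp s (k + K) (w i) ^ 2 :=
      (summable_sum fun i _ => hsi i).mul_left _
    calc ∑' k, comp s (k + K) z ^ 2
        ≤ ∑' k, (m : ℝ) * ∑ i ∈ Finset.range m, comp s (k + K) (w i) ^ 2 := by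
          refine ((summable_nat_add_iff (f := fun k => comp s k z ^ 2) K).2 hsz).tsum_le_tsum
            (fun k => ?_) hS
          refine (pow_le_pow_left₀ (comp_nonneg s _ z) (comp_sum_le s _ m w) 2).trans ?_
          have := sq_sum_le_card_mul_sum_sq (s := Finset.range m)
            (f := fun i => comp s (k + K) (w i))
          simpa using this
      _ = m * ∑ i ∈ Finset.range m, ∑' k, comp s (k + K) (w i) ^ 2 := by
          rw [tsum_mul_left, Summable.tsum_finsetSum fun i _ => hsi i]
      _ ≤ m * ∑ i ∈ Finset.range m, τ := by
          gcongr with i hi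
          exact hτw i (Finset.mem_range.1 hi)
      _ = _ := by simp
  have hsq : (99 / 100 * (m : ℝ)) ^ 2 ≤ ‖toX s z‖ ^ 2 := by gcongr
  rw [heq, ← hsz.sum_add_tsum_nat_add K] at hsq
  -- The square of the norm is at most `(0.04 + 0.5) m²`, below `0.99² m²`.
  nlinarith

/-- There are no almost isometric copies of the `ℓ₁` basis among the blocks. The vectors `z i t`
are copies of the `i`-th vector, moved out as `t` grows. -/
theorem not_almost_isometric_ell1 (z : ℕ → ℕ → ℕ →₀ ℝ)
    (hz : ∀ i j, i < j → ∀ t t', t ≤ t' → ∀ a ∈ (z i t).support, ∀ b ∈ (z j t').support, a < b)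
    (h1 : ∀ i, ∀ᶠ t in atTop, ‖toX s (z i t)‖ ≤ 1)
    (h2 : ∀ i j, i < j → ∀ᶠ t in atTop, ∀ t', t ≤ t' → 99 / 50 ≤ ‖toX s (z i t + z j t')‖)
    (h3 : ∀ m, 1 ≤ m → ∀ᶠ t in atTop,
      99 / 100 * m ≤ ‖toX s (∑ i ∈ Finset.range m, z (i + 2) t)‖) : False := by
  have hd : ∀ i j, i < j → ∀ t t', t ≤ t' → ∀ a, z i t a = 0 ∨ z j t' a = 0 := by
    intro i j hij t t' ht a
    by_contra! h
    exact (hz i j hij t t' ht a (Finsupp.mem_support_iff.2 h.1) a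
      (Finsupp.mem_support_iff.2 h.2)).false
  obtain ⟨t₁, ht₁, ht₁'⟩ := ((h1 0).and (h2 0 1 one_pos)).exists
  obtain ⟨K, hK⟩ : ∃ K, ∑' k, comp s (k + K) (z 0 t₁) ^ 2 ≤ 1 / 400 := by
    have := tendsto_sum_nat_add fun k => comp s k (z 0 t₁) ^ 2
    exact (this.eventually_le_const (by norm_num)).exists
  have hone : ∀ᶠ t in atTop, ∑' k, comp s (k + K) (z 1 t) ^ 2 ≤ 165 / 1000 := by
    filter_upwards [h1 1, eventually_ge_atTop t₁] with t ht hle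
    have := tail_comp_sq_le s (hd 0 1 one_pos t₁ t hle) ht₁ ht (ht₁' t hle) K
    linarith
  -- The threshold in `h2` depends on the pair, so the fixed `z 0 t₁` need not be comparable with
  -- all later vectors. Since `hone` holds with the same `K` for all large `t`, `z 1` can be moved
  -- out separately for each `i`: `2 · 0.165 + 0.16 = 0.49`.
  have htwo : ∀ i, ∀ᶠ t in atTop, ∑' k, comp s (k + K) (z (i + 2) t) ^ 2 ≤ 49 / 100 := by
    intro i
    obtain ⟨t₂, ⟨ha, hb⟩, hc⟩ := ((h1 1).and (h2 1 (i + 2) (by omega))).and hone |>.exists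
    filter_upwards [h1 (i + 2), eventually_ge_atTop t₂] with t ht hle
    have := tail_comp_sq_le s (hd 1 (i + 2) (by omega) t₂ t hle) ha ht (hb t hle) K
    linarith
  obtain ⟨m, hm1, hm⟩ := exists_norm_sum_lt s K (τ := 49 / 100) (by norm_num)
  have hall1 : ∀ᶠ t in atTop, ∀ i ∈ Finset.range m, ‖toX s (z (i + 2) t)‖ ≤ 1 :=
    (Finset.eventually_all _).2 fun i _ => h1 (i + 2)
  have hall2 : ∀ᶠ t in atTop, ∀ i ∈ Finset.range m,
      ∑' k, comp s (k + K) (z (i + 2) t) ^ 2 ≤ 49 / 100 :=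
    (Finset.eventually_all _).2 fun i _ => htwo i
  obtain ⟨t, ⟨ha, hb⟩, hc⟩ := (hall1.and hall2).and (h3 m hm1) |>.exists
  exact (hm (fun i => z (i + 2) t)
    (fun i j hij a ha b hb => hz _ _ (by omega) t t le_rfl a ha b hb)
    (fun i hi => ha i (Finset.mem_range.2 hi))
    (fun i hi => hb i (Finset.mem_range.2 hi))).not_ge hc

/-! ### Seminorms on `c₀₀`: distortion of `ℓ₁` and gliding humps -/

section Abstract

variable {F : Type*} [NormedAddCommGroup F] [NormedSpace ℝ F] (L : (ℕ →₀ ℝ) →ₗ[ℝ] F)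

/-- A lower `ℓ₁` estimate, with constant `c`, for nonnegative combinations. -/
def LowerEll1 (c : ℝ) (w : ℕ → ℕ →₀ ℝ) : Prop :=
  ∀ b : ℕ →₀ ℝ, (∀ i, 0 ≤ b i) →
    c * b.sum (fun _ r => r) ≤ ‖L (Finsupp.linearCombination ℝ w b)‖

/-- The coefficient sum is a linear functional; so passing to blocks of coefficient sum 1 preserves
the ℓ₁ weight of nonnegative combinations. -/
lemma sum_linearCombination (y : ℕ → ℕ →₀ ℝ) (b : ℕ →₀ ℝ) :
    (Finsupp.linearCombination ℝ y b).sum (fun _ r => r) =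
      b.sum fun i r => r * (y i).sum fun _ r => r := by
  let S : (ℕ →₀ ℝ) →ₗ[ℝ] ℝ := Finsupp.linearCombination ℝ fun _ => (1 : ℝ)
  have hS : ∀ x : ℕ →₀ ℝ, x.sum (fun _ r => r) = S x := fun x => by
    simp [S, Finsupp.linearCombination_apply]
  simp only [hS]
  rw [Finsupp.linearCombination_apply ℝ b, map_finsuppSum]
  simp

lemma norm_linearCombination_le {C : ℝ} {w : ℕ → ℕ →₀ ℝ} (hC : ∀ i, ‖L (w i)‖ ≤ C) (b : ℕ →₀ ℝ)
    (hb : ∀ i, 0 ≤ b i) :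
    ‖L (Finsupp.linearCombination ℝ w b)‖ ≤ C * b.sum (fun _ r => r) := by
  rw [Finsupp.linearCombination_apply, Finsupp.sum, map_sum, Finsupp.sum, Finset.mul_sum]
  refine (norm_sum_le _ _).trans (Finset.sum_le_sum fun i _ => ?_)
  rw [map_smul, norm_smul, Real.norm_of_nonneg (hb i), mul_comm]
  exact mul_le_mul_of_nonneg_right (hC i) (hb i)

lemma mem_support_linearCombination {w : ℕ → ℕ →₀ ℝ} {b : ℕ →₀ ℝ} {a : ℕ}
    (h : a ∈ (Finsupp.linearCombination ℝ w b).support) :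
    ∃ i ∈ b.support, a ∈ (w i).support := by
  by_contra! hcon
  rw [Finsupp.mem_support_iff, Finsupp.linearCombination_apply, Finsupp.sum,
    Finsupp.finsetSum_apply] at h
  refine h (Finset.sum_eq_zero fun i hi => ?_)
  rw [Finsupp.smul_apply, Finsupp.notMem_support_iff.1 (hcon i hi), smul_zero]

/-- James' distortion argument: a block sequence with a lower `ℓ₁` estimate has blocks which are
almost isometric to the unit vector basis of `ℓ₁`. -/
theorem exists_almost_isometric {C c : ℝ} (hc : 0 < c) {w : ℕ → ℕ →₀ ℝ} (hw : IsBlock w)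
    (hC : ∀ i, ‖L (w i)‖ ≤ C) (hl : LowerEll1 L c w) :
    ∃ y : ℕ → ℕ →₀ ℝ, IsBlock y ∧ (∀ i, ‖L (y i)‖ < 1) ∧ LowerEll1 L (199 / 200) y := by
  -- The norms of convex combinations of the `w i` with `i ≥ n`. Their infima increase with `n` to a
  -- limit `l > 0`; beyond `n₀` no such norm is much below `l`, yet norms near `l` occur arbitrarily
  -- far out.
  let A : ℕ → Set ℝ := fun n => {r | ∃ b : ℕ →₀ ℝ, (∀ i, 0 ≤ b i) ∧ (∀ i < n, b i = 0) ∧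
    b.sum (fun _ r => r) = 1 ∧ r = ‖L (Finsupp.linearCombination ℝ w b)‖}
  have hA : ∀ n, (A n).Nonempty := fun n =>
    ⟨_, Finsupp.single n 1, fun i => by
      rw [Finsupp.single_apply]; split_ifs <;> norm_num, fun i hi => by
      rw [Finsupp.single_eq_of_ne (by omega)], by simp, rfl⟩
  have hlow : ∀ n, ∀ r ∈ A n, c ≤ r := by
    rintro n r ⟨b, hb, -, hb1, rfl⟩
    simpa [hb1] using hl b hb
  have hup : ∀ n, ∀ r ∈ A n, r ≤ C := by
    rintro n r ⟨b, hb, -, hb1, rfl⟩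
    simpa [hb1] using norm_linearCombination_le L hC b hb
  have hbdd : ∀ n, BddBelow (A n) := fun n => ⟨c, fun r hr => hlow n r hr⟩
  have hle : ∀ n, c ≤ sInf (A n) := fun n => le_csInf (hA n) (hlow n)
  have hbdd' : BddAbove (Set.range fun n => sInf (A n)) := by
    refine ⟨C, ?_⟩
    rintro _ ⟨n, rfl⟩
    obtain ⟨r, hr⟩ := hA n
    exact (csInf_le (hbdd n) hr).trans (hup n r hr)
  set l := ⨆ n, sInf (A n) with hldef
  have hlc : c ≤ l := (hle 0).trans (le_ciSup hbdd' 0)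
  have hl0 : 0 < l := hc.trans_le hlc
  obtain ⟨n₀, hn₀⟩ : ∃ n₀, 999 / 1000 * l < sInf (A n₀) :=
    exists_lt_of_lt_ciSup (by linarith)
  have hex : ∀ n, ∃ b : ℕ →₀ ℝ, (∀ i, 0 ≤ b i) ∧ (∀ i < n, b i = 0) ∧
      b.sum (fun _ r => r) = 1 ∧ ‖L (Finsupp.linearCombination ℝ w b)‖ < 1001 / 1000 * l := by
    intro n
    have : sInf (A n) < 1001 / 1000 * l := (le_ciSup hbdd' n).trans_lt (by linarith)
    obtain ⟨r, ⟨b, h1, h2, h3, rfl⟩, hr⟩ := exists_lt_of_csInf_lt (hA n) this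
    exact ⟨b, h1, h2, h3, hr⟩
  choose β hβ0 hβn hβ1 hβ using hex
  let N : ℕ → ℕ := fun i => Nat.rec n₀ (fun _ m => max m ((β m).support.sup id + 1)) i
  have hNs : ∀ i, N (i + 1) = max (N i) ((β (N i)).support.sup id + 1) := fun i => rfl
  have hNm : Monotone N := monotone_nat_of_le_succ fun i => by rw [hNs]; exact le_max_left _ _
  have hN0 : ∀ i, n₀ ≤ N i := fun i => hNm (Nat.zero_le i)
  have hsupp : ∀ i, ∀ k ∈ (β (N i)).support, N i ≤ k ∧ k < N (i + 1) := by
    intro i k hk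
    constructor
    · by_contra! h
      exact Finsupp.mem_support_iff.1 hk (hβn _ k h)
    · rw [hNs]
      refine lt_max_of_lt_right (Nat.lt_succ_of_le ?_)
      exact Finset.le_sup (f := id) hk
  -- This scaling makes the norms strictly less than 1, and `999 / 1001 > 199 / 200` gives the lower
  -- estimate.
  set d : ℝ := (1001 / 1000 * l)⁻¹ with hd
  have hdpos : 0 < d := by positivity
  refine ⟨fun i => d • Finsupp.linearCombination ℝ w (β (N i)), ?_, ?_, ?_⟩
  · intro i j hij a ha b hb
    obtain ⟨k, hk, hka⟩ := mem_support_linearCombination (Finsupp.support_smul ha)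
    obtain ⟨k', hk', hkb⟩ := mem_support_linearCombination (Finsupp.support_smul hb)
    refine hw k k' ?_ a hka b hkb
    exact (hsupp i k hk).2.trans_le ((hNm hij).trans (hsupp j k' hk').1)
  · intro i
    rw [map_smul, norm_smul, Real.norm_of_nonneg hdpos.le, hd, inv_mul_lt_iff₀ (by positivity),
      mul_one]
    exact hβ _
  · intro b hb
    set γ := Finsupp.linearCombination ℝ (fun i => β (N i)) b with hγ
    have hγs : γ.sum (fun _ r => r) = b.sum fun _ r => r := by
      rw [hγ, sum_linearCombination]
      simp [hβ1]
    have hγ0 : ∀ i, 0 ≤ γ i := fun i => by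
      rw [hγ, Finsupp.linearCombination_apply, Finsupp.sum, Finsupp.finsetSum_apply]
      exact Finset.sum_nonneg fun j _ => mul_nonneg (hb j) (hβ0 _ _)
    have hγn : ∀ i < n₀, γ i = 0 := fun i hi => by
      rw [hγ, Finsupp.linearCombination_apply, Finsupp.sum, Finsupp.finsetSum_apply]
      refine Finset.sum_eq_zero fun j _ => ?_
      rw [Finsupp.smul_apply, hβn _ i (hi.trans_le (hN0 j)), smul_zero]
    have hcomb : Finsupp.linearCombination ℝ
        (fun i => d • Finsupp.linearCombination ℝ w (β (N i))) b =
        d • Finsupp.linearCombination ℝ w γ := by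
      rw [hγ]
      simp only [Finsupp.linearCombination_apply ℝ b, Finsupp.sum, map_sum, map_smul,
        Finset.smul_sum]
      exact Finset.sum_congr rfl fun i _ => smul_comm _ _ _
    rw [hcomb, map_smul, norm_smul, Real.norm_of_nonneg hdpos.le, ← hγs]
    set S := γ.sum fun _ r => r with hS
    have hS0 : 0 ≤ S := Finsupp.sum_nonneg fun i _ => hγ0 i
    rcases hS0.eq_or_lt with h | h
    · rw [← h, mul_zero]; positivity
    have hmem : ‖L (Finsupp.linearCombination ℝ w (S⁻¹ • γ))‖ ∈ A n₀ := by
      refine ⟨S⁻¹ • γ, fun i => mul_nonneg (inv_nonneg.2 hS0) (hγ0 i), fun i hi => ?_, ?_, rfl⟩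
      · rw [Finsupp.smul_apply, hγn i hi, smul_zero]
      · rw [Finsupp.sum_smul_index fun _ => rfl, ← Finsupp.mul_sum]
        exact inv_mul_cancel₀ h.ne'
    have h1 := hn₀.trans_le (csInf_le (hbdd n₀) hmem)
    rw [map_smul, map_smul, norm_smul, norm_inv, Real.norm_of_nonneg hS0,
      lt_inv_mul_iff₀ h] at h1
    rw [hd, inv_mul_eq_div, le_div_iff₀ (by positivity)]
    nlinarith [mul_pos hl0 h]

end Abstract

/-! ### Gliding humps: from copies of ℓ₁ and c₀ to blocks. -/

section Abstract

variable {F : Type*} [NormedAddCommGroup F] [NormedSpace ℝ F] (L : (ℕ →₀ ℝ) →ₗ[ℝ] F)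

lemma LowerEll1.le_norm_add {L : (ℕ →₀ ℝ) →ₗ[ℝ] F} {c : ℝ} {y : ℕ → ℕ →₀ ℝ}
    (h : LowerEll1 L c y) (i j : ℕ) : c * 2 ≤ ‖L (y i + y j)‖ := by
  have := h (Finsupp.single i 1 + Finsupp.single j 1) fun k => by
    simp only [Finsupp.add_apply, Finsupp.single_apply]
    positivity
  rw [Finsupp.sum_add_index' (fun _ => rfl) (fun _ _ _ => rfl), map_add] at this
  simpa [one_add_one_eq_two] using this

lemma LowerEll1.le_norm_sum {L : (ℕ →₀ ℝ) →ₗ[ℝ] F} {c : ℝ} {y : ℕ → ℕ →₀ ℝ}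
    (h : LowerEll1 L c y) (m : ℕ) : c * m ≤ ‖L (∑ i ∈ Finset.range m, y (i + 2))‖ := by
  have := h (∑ i ∈ Finset.range m, Finsupp.single (i + 2) 1) fun k => by
    rw [Finsupp.finsetSum_apply]
    refine Finset.sum_nonneg fun i _ => ?_
    rw [Finsupp.single_apply]
    positivity
  rw [← Finsupp.sum_finsetSum_index (fun _ => rfl) (fun _ _ _ => rfl), map_sum] at this
  simpa using this

lemma abs_apply_le_norm {L : (ℕ →₀ ℝ) →ₗ[ℝ] F} (hs : ∀ E x, ‖L (restr E x)‖ ≤ ‖L x‖)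
    (hone : ∀ j, ‖L (Finsupp.single j 1)‖ = 1) (x : ℕ →₀ ℝ) (j : ℕ) : |x j| ≤ ‖L x‖ := by
  have h : restr {j} x = x j • Finsupp.single j 1 := by
    ext i
    rw [restr_apply, Finsupp.smul_apply, Finsupp.single_apply]
    by_cases h : j = i
    · simp [h]
    · simp [h, Ne.symm h]
  have := hs {j} x
  rwa [h, map_smul, norm_smul, hone, mul_one, Real.norm_eq_abs] at this

/-- By compactness, two far out terms of a bounded sequence almost agree on an initial segment. -/
lemma exists_almost_agree {L : (ℕ →₀ ℝ) →ₗ[ℝ] F} (hs : ∀ E x, ‖L (restr E x)‖ ≤ ‖L x‖)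
    (hone : ∀ j, ‖L (Finsupp.single j 1)‖ = 1) {t : ℕ → ℕ →₀ ℝ} {C : ℝ}
    (hC : ∀ i, ‖L (t i)‖ ≤ C) (M : ℕ) {δ : ℝ} (hδ : 0 < δ) :
    ∃ g h, M ≤ g ∧ g < h ∧ ‖L (restr (Finset.range M) (t g - t h))‖ ≤ δ := by
  have hb : Bornology.IsBounded (Set.range fun i : ℕ => fun j : Fin M => t i j) := by
    refine (Metric.isBounded_closedBall (x := (0 : Fin M → ℝ)) (r := max C 0)).subset ?_
    rintro _ ⟨i, rfl⟩
    rw [mem_closedBall_zero_iff, pi_norm_le_iff_of_nonneg (le_max_right _ _)]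
    exact fun j => ((abs_apply_le_norm hs hone (t i) j).trans (hC i)).trans (le_max_left _ _)
  obtain ⟨a, -, φ, hφ, ha⟩ := tendsto_subseq_of_bounded hb fun i => Set.mem_range_self i
  have hcs := ha.cauchySeq
  rw [Metric.cauchySeq_iff] at hcs
  obtain ⟨N, hN⟩ := hcs (δ / (M + 1)) (by positivity)
  set k := max M N
  refine ⟨φ k, φ (k + 1), (le_max_left M N).trans (hφ.id_le k), hφ (Nat.lt_succ_self k), ?_⟩
  have hd := hN k (le_max_right _ _) (k + 1) ((le_max_right M N).trans (Nat.le_succ _))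
  set x := t (φ k) - t (φ (k + 1)) with hx
  have hxj : ∀ j ∈ Finset.range M, |x j| ≤ δ / (M + 1) := fun j hj => by
    have := (dist_le_pi_dist _ _ ⟨j, Finset.mem_range.1 hj⟩).trans hd.le
    rw [hx, Finsupp.sub_apply]
    simpa [Real.dist_eq] using this
  have hr : restr (Finset.range M) x = ∑ j ∈ Finset.range M, x j • Finsupp.single j 1 := by
    ext i
    rw [restr_apply, Finsupp.finsetSum_apply]
    simp [Finsupp.single_apply]
  rw [hr, map_sum]
  calc _ ≤ ∑ j ∈ Finset.range M, ‖L (x j • Finsupp.single j 1)‖ := norm_sum_le _ _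
    _ ≤ ∑ j ∈ Finset.range M, δ / (M + 1) := by
        refine Finset.sum_le_sum fun j hj => ?_
        rw [map_smul, norm_smul, hone, mul_one]
        exact hxj j hj
    _ = M * (δ / (M + 1)) := by simp
    _ ≤ δ := by
        rw [mul_div_assoc', div_le_iff₀ (by positivity)]
        nlinarith

/-- The gliding hump argument, for differences of the terms of a bounded sequence. -/
theorem exists_block_near {L : (ℕ →₀ ℝ) →ₗ[ℝ] F} (hs : ∀ E x, ‖L (restr E x)‖ ≤ ‖L x‖)
    (hone : ∀ j, ‖L (Finsupp.single j 1)‖ = 1) {t : ℕ → ℕ →₀ ℝ} {C : ℝ}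
    (hC : ∀ i, ‖L (t i)‖ ≤ C) {δ : ℕ → ℝ} (hδ : ∀ k, 0 < δ k) :
    ∃ (g h : ℕ → ℕ) (w : ℕ → ℕ →₀ ℝ), IsBlock w ∧ (∀ k, g k < h k) ∧ (∀ k, h k < g (k + 1)) ∧
      (∀ k, ‖L (w k)‖ ≤ 2 * C) ∧ ∀ k, ‖L (t (g k)) - L (t (h k)) - L (w k)‖ ≤ δ k := by
  choose g h hMg hgh hgap using fun (M k : ℕ) => exists_almost_agree hs hone hC M (hδ k)
  -- `N (k + 1)` lies beyond both chosen indices and the support of the `k`-th difference. That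
  -- difference is almost zero before `N k`, so cutting it to `[N k, N (k + 1))` costs at most `δ
  -- k`.
  let N : ℕ → ℕ := fun k => Nat.rec 0
    (fun k M => max (h M k + 1) ((t (g M k) - t (h M k)).support.sup id + 1)) k
  have hNs : ∀ k, N (k + 1) = max (h (N k) k + 1)
    ((t (g (N k) k) - t (h (N k) k)).support.sup id + 1) := fun k => rfl
  have hhN : ∀ k, h (N k) k < N (k + 1) := fun k => by
    rw [hNs]; exact lt_max_of_lt_left (Nat.lt_succ_self _)
  have hNm : Monotone N := monotone_nat_of_le_succ fun k =>
    ((hMg _ k).trans (hgh _ k).le).trans (hhN k).le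
  let x : ℕ → ℕ →₀ ℝ := fun k => t (g (N k) k) - t (h (N k) k)
  have hx : ∀ k, (x k).support ⊆ Finset.range (N (k + 1)) := fun k a ha => by
    rw [Finset.mem_range, hNs]
    refine lt_max_of_lt_right (Nat.lt_succ_of_le ?_)
    exact Finset.le_sup (f := id) ha
  refine ⟨fun k => g (N k) k, fun k => h (N k) k,
    fun k => restr (Finset.Ico (N k) (N (k + 1))) (x k), ?_, fun k => hgh _ _,
    fun k => (hhN k).trans_le (hMg _ _), fun k => ?_, fun k => ?_⟩
  · intro i j hij a ha b hb
    have ha' := Finset.mem_Ico.1 (Finset.mem_inter.1 (support_restr _ _ ha)).1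
    have hb' := Finset.mem_Ico.1 (Finset.mem_inter.1 (support_restr _ _ hb)).1
    exact ha'.2.trans_le ((hNm hij).trans hb'.1)
  · refine (hs _ _).trans ?_
    rw [map_sub]
    refine (norm_sub_le _ _).trans ?_
    linarith [hC (g (N k) k), hC (h (N k) k)]
  · refine le_trans (le_of_eq ?_) (hgap (N k) k)
    rw [← map_sub, ← map_sub]
    congr 2
    change x k - restr (Finset.Ico (N k) (N (k + 1))) (x k) = restr (Finset.range (N k)) (x k)
    ext a
    rw [Finsupp.sub_apply, restr_apply, restr_apply]
    by_cases ha : a ∈ (x k).support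
    · have := Finset.mem_range.1 (hx k ha)
      rcases lt_or_ge a (N k) with h' | h'
      · rw [if_neg fun h => (Finset.mem_Ico.1 h).1.not_gt h', if_pos (Finset.mem_range.2 h'),
          sub_zero]
      · rw [if_pos (Finset.mem_Ico.2 ⟨h', this⟩), if_neg fun h => (Finset.mem_range.1 h).not_ge h',
          sub_self]
    · simp [Finsupp.notMem_support_iff.1 ha]

lemma exists_approx {L : (ℕ →₀ ℝ) →ₗ[ℝ] F} {v : ℕ → F}
    (hv : ∀ i, v i ∈ closure (Set.range L)) {δ : ℕ → ℝ} (hδ : ∀ k, 0 < δ k) :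
    ∃ t : ℕ → ℕ →₀ ℝ, ∀ i, ‖v i - L (t i)‖ < δ i := by
  have : ∀ i, ∃ x : ℕ →₀ ℝ, ‖v i - L x‖ < δ i := fun i => by
    obtain ⟨_, ⟨x, rfl⟩, hx⟩ := Metric.mem_closure_iff.1 (hv i) (δ i) (hδ i)
    exact ⟨x, by rwa [dist_eq_norm] at hx⟩
  exact ⟨fun i => (this i).choose, fun i => (this i).choose_spec⟩

lemma strictMono_of_interlaced {g h : ℕ → ℕ} (hgh : ∀ k, g k < h k) (hhg : ∀ k, h k < g (k + 1)) :
    StrictMono g ∧ StrictMono h ∧ ∀ i j, g i ≠ h j := by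
  have hg : StrictMono g := strictMono_nat_of_lt_succ fun k => (hgh k).trans (hhg k)
  have hh : StrictMono h := strictMono_nat_of_lt_succ fun k => (hhg k).trans (hgh _)
  refine ⟨hg, hh, fun i j hij => ?_⟩
  rcases le_or_gt i j with h' | h'
  · exact ((hg.monotone h').trans_lt (hgh j)).ne hij
  · exact ((hhg j).trans_le (hg.monotone h')).ne' hij

/-- A copy of `ℓ₁` in the closure of the image of `c₀₀` gives blocks with a lower `ℓ₁` estimate. -/
theorem exists_block_of_ell1 {L : (ℕ →₀ ℝ) →ₗ[ℝ] F} (hs : ∀ E x, ‖L (restr E x)‖ ≤ ‖L x‖)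
    (hone : ∀ j, ‖L (Finsupp.single j 1)‖ = 1) (T : Ell1 →L[ℝ] F)
    (hT : ∀ x, T x ∈ closure (Set.range L)) {c : ℝ} (hc : 0 < c) (hTc : ∀ x, c * ‖x‖ ≤ ‖T x‖) :
    ∃ (C c' : ℝ) (w : ℕ → ℕ →₀ ℝ), 0 < c' ∧ IsBlock w ∧ (∀ i, ‖L (w i)‖ ≤ C) ∧
      LowerEll1 L c' w := by
  let e : ℕ → Ell1 := fun i => lp.single 1 i 1
  have hδ : ∀ _ : ℕ, 0 < c / 4 := fun _ => by positivity
  obtain ⟨t, ht⟩ := exists_approx (fun i => hT (e i)) hδ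
  have hC : ∀ i, ‖L (t i)‖ ≤ ‖T‖ + c / 4 := fun i => by
    have h1 : ‖T (e i)‖ ≤ ‖T‖ := by
      have := T.le_opNorm (e i)
      rwa [lp.norm_single (by norm_num), norm_one, mul_one] at this
    have h2 := norm_sub_norm_le (L (t i)) (T (e i))
    rw [norm_sub_rev] at h2
    linarith [ht i]
  obtain ⟨g, h, w, hw, hgh, hhg, hwC, hwt⟩ := exists_block_near hs hone hC hδ
  obtain ⟨hg, -, hne⟩ := strictMono_of_interlaced hgh hhg
  refine ⟨_, c / 4, w, by positivity, hw, hwC, fun b hb => ?_⟩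
  set S := b.sum fun _ r => r with hS
  -- The indices `g k`, `h k` are all distinct, so the coordinates at the `g k` alone give norm at
  -- least `S`. The three approximation errors leave `c - 3c/4 = c/4`.
  let v : Ell1 := ∑ k ∈ b.support, b k • (e (g k) - e (h k))
  have hvg : ∀ i ∈ b.support, v (g i) = b i := fun i hi => by
    simp only [v, lp.coeFn_sum, Finset.sum_apply, lp.coeFn_smul, Pi.smul_apply, lp.coeFn_sub,
      Pi.sub_apply, e, lp.single_apply]
    rw [Finset.sum_eq_single_of_mem i hi]
    · simp [hne]
    · intro j _ hj
      simp [hne, hg.injective.ne hj.symm]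
  have hv : S ≤ ‖v‖ := by
    have := lp.sum_rpow_le_norm_rpow (p := 1) (by norm_num) v (b.support.map ⟨g, hg.injective⟩)
    rw [Finset.sum_map] at this
    simp only [ENNReal.toReal_one, Real.rpow_one, Function.Embedding.coeFn_mk] at this
    refine le_trans (Finset.sum_le_sum fun i hi => ?_) this
    rw [hvg i hi]
    exact le_abs_self _
  have hdiff : ‖T v - L (Finsupp.linearCombination ℝ w b)‖ ≤ 3 * (c / 4) * S := by
    have : T v - L (Finsupp.linearCombination ℝ w b) =
        ∑ k ∈ b.support, b k • (T (e (g k)) - T (e (h k)) - L (w k)) := by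
      simp only [v, map_sum, map_smul, map_sub, Finsupp.linearCombination_apply, Finsupp.sum,
        smul_sub, Finset.sum_sub_distrib]
    rw [this, hS, Finsupp.sum, Finset.mul_sum]
    refine (norm_sum_le _ _).trans (Finset.sum_le_sum fun k _ => ?_)
    rw [norm_smul, Real.norm_of_nonneg (hb k), mul_comm]
    refine mul_le_mul_of_nonneg_right ?_ (hb k)
    have h3 : T (e (g k)) - T (e (h k)) - L (w k) = (T (e (g k)) - L (t (g k))) -
        (T (e (h k)) - L (t (h k))) + (L (t (g k)) - L (t (h k)) - L (w k)) := by abel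
    rw [h3]
    have := (norm_add_le ((T (e (g k)) - L (t (g k))) - (T (e (h k)) - L (t (h k))))
      (L (t (g k)) - L (t (h k)) - L (w k))).trans (add_le_add (norm_sub_le _ _) (hwt k))
    linarith [ht (g k), ht (h k)]
  have h1 := hTc v
  have h2 := norm_sub_norm_le (T v) (L (Finsupp.linearCombination ℝ w b))
  nlinarith

/-- The indicator of a finite set, in `c₀`. -/
def indicatorCZero (G : Finset ℕ) : CZero where
  toFun i := if i ∈ G then 1 else 0
  continuous_toFun := continuous_of_discreteTopology
  zero_at_infty' := by
    rw [cocompact_eq_cofinite, Nat.cofinite_eq_atTop]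
    refine tendsto_const_nhds.congr' ?_
    filter_upwards [eventually_gt_atTop (G.sup id)] with i hi
    rw [if_neg]
    exact fun h => (Finset.le_sup (f := id) h).not_gt hi

lemma indicatorCZero_apply (G : Finset ℕ) (i : ℕ) :
    indicatorCZero G i = if i ∈ G then 1 else 0 := rfl

lemma norm_indicatorCZero_le (G : Finset ℕ) : ‖indicatorCZero G‖ ≤ 1 := by
  rw [← ZeroAtInftyContinuousMap.norm_toBCF_eq_norm, BoundedContinuousFunction.norm_le zero_le_one]
  intro i
  change ‖indicatorCZero G i‖ ≤ 1
  rw [indicatorCZero_apply]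
  split_ifs <;> simp

lemma sum_indicatorCZero {g : ℕ → ℕ} (hg : Function.Injective g) (G : Finset ℕ) :
    ∑ k ∈ G, indicatorCZero {g k} = indicatorCZero (G.map ⟨g, hg⟩) := by
  induction G using Finset.induction_on with
  | empty => ext i; simp [indicatorCZero_apply]
  | insert a G ha ih =>
    rw [Finset.sum_insert ha, ih]
    ext i
    simp only [ZeroAtInftyContinuousMap.coe_add, Pi.add_apply, indicatorCZero_apply,
      Finset.mem_singleton, Finset.mem_map, Finset.mem_insert, Function.Embedding.coeFn_mk,
      exists_eq_or_imp]
    by_cases h : i = g a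
    · have : ¬ ∃ b ∈ G, g b = i := by
        rintro ⟨b, hb, rfl⟩
        exact ha (hg h ▸ hb)
      simp [h] at this ⊢
      exact this
    · simp [h, Ne.symm h]

/-- A copy of `c₀` in the closure of the image of `c₀₀` gives seminormalized blocks with bounded
partial sums. -/
theorem exists_block_of_czero {L : (ℕ →₀ ℝ) →ₗ[ℝ] F} (hs : ∀ E x, ‖L (restr E x)‖ ≤ ‖L x‖)
    (hone : ∀ j, ‖L (Finsupp.single j 1)‖ = 1) (T : CZero →L[ℝ] F)
    (hT : ∀ x, T x ∈ closure (Set.range L)) {c : ℝ} (hc : 0 < c) (hTc : ∀ x, c * ‖x‖ ≤ ‖T x‖) :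
    ∃ (C c' : ℝ) (w : ℕ → ℕ →₀ ℝ), 0 < c' ∧ IsBlock w ∧ (∀ i, c' ≤ ‖L (w i)‖) ∧
      ∀ n, ‖L (∑ i ∈ Finset.range n, w i)‖ ≤ C := by
  let e : ℕ → CZero := fun i => indicatorCZero {i}
  -- Errors must be summable here, to control partial sums of any length. As `k ≤ g k` and `k ≤ h
  -- k`, approximating the original basis within `δ` suffices for the chosen terms.
  let δ : ℕ → ℝ := fun k => c / 8 * (1 / 2) ^ k
  have hδ : ∀ k, 0 < δ k := fun _ => by positivity
  have hδa : Antitone δ := fun i j hij =>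
    mul_le_mul_of_nonneg_left (pow_le_pow_of_le_one (by norm_num) (by norm_num) hij) (by positivity)
  have hδ0 : ∀ k, δ k ≤ c / 8 := fun k => by simpa [δ] using hδa (Nat.zero_le k)
  obtain ⟨t, ht⟩ := exists_approx (fun i => hT (e i)) hδ
  have hC : ∀ i, ‖L (t i)‖ ≤ ‖T‖ + c / 8 := fun i => by
    have h1 : ‖T (e i)‖ ≤ ‖T‖ := T.unit_le_opNorm _ (norm_indicatorCZero_le _)
    have h2 := norm_sub_norm_le (L (t i)) (T (e i))
    rw [norm_sub_rev] at h2
    linarith [ht i, hδ0 i]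
  obtain ⟨g, h, w, hw, hgh, hhg, hwC, hwt⟩ := exists_block_near hs hone hC hδ
  obtain ⟨hg, hh, hne⟩ := strictMono_of_interlaced hgh hhg
  have hdiff : ∀ k, ‖T (e (g k)) - T (e (h k)) - L (w k)‖ ≤ 3 * δ k := fun k => by
    have h3 : T (e (g k)) - T (e (h k)) - L (w k) = (T (e (g k)) - L (t (g k))) -
        (T (e (h k)) - L (t (h k))) + (L (t (g k)) - L (t (h k)) - L (w k)) := by abel
    rw [h3]
    have := (norm_add_le ((T (e (g k)) - L (t (g k))) - (T (e (h k)) - L (t (h k))))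
      (L (t (g k)) - L (t (h k)) - L (w k))).trans (add_le_add (norm_sub_le _ _) (hwt k))
    linarith [ht (g k), ht (h k), hδa (hg.le_apply (x := k)), hδa (hh.le_apply (x := k))]
  refine ⟨2 * ‖T‖ + c, c / 2, w, by positivity, hw, fun k => ?_, fun n => ?_⟩
  · have h1 : 1 ≤ ‖e (g k) - e (h k)‖ := by
      rw [← ZeroAtInftyContinuousMap.norm_toBCF_eq_norm]
      refine le_trans (le_of_eq ?_) (BoundedContinuousFunction.norm_coe_le_norm _ (g k))
      change 1 = ‖(e (g k) - e (h k)) (g k)‖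
      simp [e, indicatorCZero_apply, hne]
    have h2 := hTc (e (g k) - e (h k))
    rw [map_sub] at h2
    have h3 := norm_sub_norm_le (T (e (g k)) - T (e (h k))) (L (w k))
    nlinarith [hdiff k, hδ0 k]
  · have hsum : L (∑ k ∈ Finset.range n, w k) =
        T (∑ k ∈ Finset.range n, e (g k)) - T (∑ k ∈ Finset.range n, e (h k)) -
        ∑ k ∈ Finset.range n, (T (e (g k)) - T (e (h k)) - L (w k)) := by
      simp only [map_sum, Finset.sum_sub_distrib]
      abel
    have hgeo : ∑ k ∈ Finset.range n, δ k ≤ c / 4 := by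
      have hs := hasSum_geometric_two.mul_left (c / 8)
      have := hs.summable.sum_le_tsum (Finset.range n) fun k _ => (hδ k).le
      rw [hs.tsum_eq] at this
      linarith
    have herr : ‖∑ k ∈ Finset.range n, (T (e (g k)) - T (e (h k)) - L (w k))‖ ≤ c := by
      refine (norm_sum_le _ _).trans ?_
      refine (Finset.sum_le_sum fun k _ => hdiff k).trans ?_
      rw [← Finset.mul_sum]
      linarith
    have h1 : ‖T (∑ k ∈ Finset.range n, e (g k))‖ ≤ ‖T‖ :=
      T.unit_le_opNorm _ (by rw [sum_indicatorCZero hg.injective]; exact norm_indicatorCZero_le _)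
    have h2 : ‖T (∑ k ∈ Finset.range n, e (h k))‖ ≤ ‖T‖ :=
      T.unit_le_opNorm _ (by rw [sum_indicatorCZero hh.injective]; exact norm_indicatorCZero_le _)
    rw [hsum]
    refine (norm_sub_le _ _).trans ?_
    have := norm_sub_le (T (∑ k ∈ Finset.range n, e (g k))) (T (∑ k ∈ Finset.range n, e (h k)))
    linarith

end Abstract

/-! ### Blocks in `X` -/

/-- A crude way to see that `n / f n` is unbounded, from `log t ≤ t` at `t = √(1 + n)`. -/
lemma f_le_sqrt (n : ℕ) (hn : 1 ≤ n) : f n ≤ 8 * √n := by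
  have h1 : Real.log (1 + n) = 2 * Real.log √(1 + n) := by
    rw [Real.log_sqrt (by positivity)]; ring
  have h2 : Real.log √(1 + n) ≤ √(1 + n) := Real.log_le_self (Real.sqrt_nonneg _)
  have h3 : √(1 + n) ≤ 2 * √n := by
    rw [Real.sqrt_le_left (by positivity), mul_pow, Real.sq_sqrt (by positivity)]
    have : (1 : ℝ) ≤ n := by exact_mod_cast hn
    linarith
  have h4 := Real.log_two_gt_d9
  rw [f, Real.logb, h1, div_le_iff₀ (by linarith)]
  nlinarith [Real.sqrt_nonneg n]

/-- Seminormalized blocks in `X` do not have bounded partial sums. -/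
theorem not_bounded_sums {w : ℕ → ℕ →₀ ℝ} (hw : IsBlock w) {c C : ℝ} (hc : 0 < c)
    (hwc : ∀ i, c ≤ ‖toX s (w i)‖) (hC : ∀ n, ‖toX s (∑ i ∈ Finset.range n, w i)‖ ≤ C) :
    False := by
  have key : ∀ k, √(s.n k) * c ≤ 8 * C := fun k => by
    have hn := s.pos k
    have hn0 : (0 : ℝ) < s.n k := by exact_mod_cast hn
    have hf := f_le_sqrt _ hn
    have hfpos : 0 < f (s.n k) := by
      rw [f]
      exact Real.logb_pos (by norm_num) (by linarith)
    have h1 := (sum_norm_le s k hw).trans (hC _)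
    have h2 : s.n k * c ≤ ∑ i ∈ Finset.range (s.n k), ‖toX s (w i)‖ := by
      have := Finset.card_nsmul_le_sum (Finset.range (s.n k)) (fun i => ‖toX s (w i)‖) c
        fun i _ => hwc i
      simpa using this
    rw [one_div, inv_mul_le_iff₀ hfpos] at h1
    have hs0 : 0 < √(s.n k) := Real.sqrt_pos.2 hn0
    have hC0 : 0 ≤ C := (norm_nonneg _).trans (hC 0)
    have h3 : √(s.n k) * (√(s.n k) * c) ≤ √(s.n k) * (8 * C) := by
      rw [← mul_assoc, Real.mul_self_sqrt hn0.le]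
      nlinarith
    exact le_of_mul_le_mul_left h3 hs0
  obtain ⟨k, hk⟩ := exists_nat_gt ((8 * C / c) ^ 2)
  have h1 : (8 * C / c) ^ 2 < s.n k := hk.trans_le (by exact_mod_cast s.strictMono.le_apply)
  have h2 := Real.lt_sqrt_of_sq_lt h1
  rw [div_lt_iff₀ hc] at h2
  exact (key k).not_gt h2

/-- No block sequence in `X` has a lower `ℓ₁` estimate. -/
theorem not_lowerEll1 {w : ℕ → ℕ →₀ ℝ} (hw : IsBlock w) {c C : ℝ} (hc : 0 < c)
    (hC : ∀ i, ‖toX s (w i)‖ ≤ C) (hl : LowerEll1 (toX s) c w) : False := by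
  obtain ⟨y, hy, hy1, hyl⟩ := exists_almost_isometric (toX s) hc hw hC hl
  refine not_almost_isometric_ell1 s (fun i _ => y i) (fun i j hij _ _ _ => hy i j hij)
    (fun i => .of_forall fun _ => (hy1 i).le) (fun i j _ => .of_forall fun _ _ _ => ?_)
    fun m _ => .of_forall fun _ => ?_
  · exact le_trans (by norm_num) (hyl.le_norm_add i j)
  · refine le_trans ?_ (hyl.le_norm_sum m)
    exact mul_le_mul_of_nonneg_right (by norm_num) m.cast_nonneg

lemma norm_toX_single (i : ℕ) : ‖toX s (Finsupp.single i 1)‖ = 1 := norm_e s i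

theorem not_contains_ell1 : ¬ Contains (X s) Ell1 := by
  rintro ⟨T, c, hc, hT⟩
  obtain ⟨C, c', w, hc', hw, hC, hl⟩ := exists_block_of_ell1 (norm_toX_restr_le s)
    (norm_toX_single s) T (fun x => denseRange_toX s _) hc hT
  exact not_lowerEll1 s hw hc' hC hl

theorem not_contains_czero : ¬ Contains (X s) CZero := by
  rintro ⟨T, c, hc, hT⟩
  obtain ⟨C, c', w, hc', hw, hC, hl⟩ := exists_block_of_czero (norm_toX_restr_le s)
    (norm_toX_single s) T (fun x => denseRange_toX s _) hc hT
  exact not_bounded_sums s hw hc' hC hl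

/-! ### Spreading models of block bases -/

section Spreading

variable {F : Type*} [NormedAddCommGroup F] [NormedSpace ℝ F]

/-- Coefficient vectors of any length become elements of c₀₀, so that `Finsupp.linearCombination ℝ
u` can play the role of `L` in the abstract results. -/
lemma IsSpreadingModel.exists_forall {E : Type*} [NormedAddCommGroup E] [NormedSpace ℝ E]
    {x : ℕ → E} {u : ℕ → F} (h : IsSpreadingModel x u) (a : ℕ →₀ ℝ) {ε : ℝ} (hε : 0 < ε) :
    ∃ ℓ : ℕ, ∀ σ : ℕ → ℕ, StrictMono σ → ℓ ≤ σ 0 →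
      |‖Finsupp.linearCombination ℝ (x ∘ σ) a‖ - ‖Finsupp.linearCombination ℝ u a‖| < ε := by
  set m := a.support.sup id + 1
  have hm : a.support ⊆ Finset.range m := fun i hi =>
    Finset.mem_range.2 (Nat.lt_succ_of_le (Finset.le_sup (f := id) hi))
  obtain ⟨ℓ, hℓ⟩ := h m (fun j => a j) ε hε
  refine ⟨ℓ + 1, fun σ hσ hσ0 => ?_⟩
  have := hℓ (fun j => σ j) (fun i j hij => hσ hij) fun j =>
    hσ0.trans (hσ.monotone (Nat.zero_le _))
  rw [Finsupp.linearCombination_apply, Finsupp.linearCombination_apply,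
    Finsupp.sum_of_support_subset a hm _ (by simp),
    Finsupp.sum_of_support_subset a hm _ (by simp), Finset.sum_range, Finset.sum_range]
  exact this

variable {s} {x : ℕ → X s} {u : ℕ → F}

/-- A normalized block basis of `X` comes from a block sequence in `c₀₀`. -/
lemma IsNormalizedBlockBasis.exists_block (hx : IsNormalizedBlockBasis (X.e s) x) :
    ∃ ξ : ℕ → ℕ →₀ ℝ, IsBlock ξ ∧ (∀ i, toX s (ξ i) = x i) ∧ ∀ i, ‖x i‖ = 1 := by
  obtain ⟨p, hp, a, ha⟩ := hx
  have hsupp : ∀ i, ∀ k ∈ (∑ j ∈ Finset.Ico (p i) (p (i + 1)),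
      Finsupp.single j (a j) : ℕ →₀ ℝ).support, p i ≤ k ∧ k < p (i + 1) := by
    intro i k hk
    rw [← Finset.mem_Ico]
    by_contra hcon
    refine Finsupp.mem_support_iff.1 hk ?_
    rw [Finsupp.finsetSum_apply]
    exact Finset.sum_eq_zero fun j hj =>
      Finsupp.single_eq_of_ne (by rintro rfl; exact hcon hj)
  refine ⟨fun i => ∑ j ∈ Finset.Ico (p i) (p (i + 1)), Finsupp.single j (a j), ?_, fun i => ?_,
    fun i => (ha i).2⟩
  · intro i j hij k hk l hl
    exact (hsupp i k hk).2.trans_le ((hp.monotone hij).trans (hsupp j l hl).1)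
  · rw [(ha i).1, map_sum]
    exact Finset.sum_congr rfl fun j _ => toX_single s j (a j)

lemma toX_linearCombination {ξ : ℕ → ℕ →₀ ℝ} (hξx : ∀ i, toX s (ξ i) = x i) (σ : ℕ → ℕ)
    (a : ℕ →₀ ℝ) : toX s (Finsupp.linearCombination ℝ (ξ ∘ σ) a) =
      Finsupp.linearCombination ℝ (x ∘ σ) a := by
  simp [Finsupp.linearCombination_apply, Finsupp.sum, hξx]

/-- Dropping coefficients of a block combination is a restriction in c₀₀, so contractivity of
restrictions passes from `X` to the spreading model. -/
lemma linearCombination_restr {ξ : ℕ → ℕ →₀ ℝ} (hξ : IsBlock ξ) {σ : ℕ → ℕ} (hσ : StrictMono σ)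
    (E : Finset ℕ) (a : ℕ →₀ ℝ) : Finsupp.linearCombination ℝ (ξ ∘ σ) (restr E a) =
      restr (E.biUnion fun j => (ξ (σ j)).support) (Finsupp.linearCombination ℝ (ξ ∘ σ) a) := by
  induction a using Finsupp.induction_linear with
  | zero =>
    have : ∀ G : Finset ℕ, restr G 0 = 0 := fun G => restr_eq_zero (by simp)
    simp [this]
  | add a b ha hb => rw [restr_add, map_add, map_add, restr_add, ha, hb]
  | single j c =>
    simp only [Finsupp.linearCombination_single, Function.comp_apply, restr_smul]
    by_cases hj : j ∈ E
    · rw [restr_eq_self, Finsupp.linearCombination_single, restr_eq_self]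
      · rfl
      · exact Finset.subset_biUnion_of_mem (fun j => (ξ (σ j)).support) hj
      · exact Finsupp.support_single_subset.trans (Finset.singleton_subset_iff.2 hj)
    · rw [restr_eq_zero, map_zero, restr_eq_zero, smul_zero]
      · intro k hk hk'
        obtain ⟨i, hi, hki⟩ := Finset.mem_biUnion.1 hk
        rcases lt_trichotomy i j with h | rfl | h
        · exact (hξ _ _ (hσ h) k hki k hk').false
        · exact hj hi
        · exact (hξ _ _ (hσ h) k hk' k hki).false
      · intro k hk hk'
        have := Finset.mem_singleton.1 (Finsupp.support_single_subset hk')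
        exact hj (this ▸ hk)

lemma strictMono_add (t : ℕ) : StrictMono fun j => t + j := fun _ _ h => Nat.add_lt_add_left h t

lemma norm_linearCombination_restr_le (hx : IsNormalizedBlockBasis (X.e s) x)
    (hu : IsSpreadingModel x u) (E : Finset ℕ) (a : ℕ →₀ ℝ) :
    ‖Finsupp.linearCombination ℝ u (restr E a)‖ ≤ ‖Finsupp.linearCombination ℝ u a‖ := by
  obtain ⟨ξ, hξ, hξx, -⟩ := hx.exists_block
  refine le_of_forall_pos_le_add fun ε hε => ?_
  obtain ⟨ℓ₁, h₁⟩ := hu.exists_forall a (half_pos hε)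
  obtain ⟨ℓ₂, h₂⟩ := hu.exists_forall (restr E a) (half_pos hε)
  have hσ := strictMono_add (ℓ₁ + ℓ₂)
  have h1 := abs_lt.1 (h₁ _ hσ (by omega))
  have h2 := abs_lt.1 (h₂ _ hσ (by omega))
  have h3 := norm_toX_restr_le s (E.biUnion fun j => (ξ (ℓ₁ + ℓ₂ + j)).support)
    (Finsupp.linearCombination ℝ (ξ ∘ fun j => ℓ₁ + ℓ₂ + j) a)
  rw [← linearCombination_restr hξ hσ, toX_linearCombination hξx, toX_linearCombination hξx] at h3
  linarith

lemma norm_linearCombination_single (hx : IsNormalizedBlockBasis (X.e s) x)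
    (hu : IsSpreadingModel x u) (j : ℕ) :
    ‖Finsupp.linearCombination ℝ u (Finsupp.single j 1)‖ = 1 := by
  obtain ⟨ξ, -, -, hx1⟩ := hx.exists_block
  refine eq_of_forall_dist_le fun ε hε => ?_
  obtain ⟨ℓ, h⟩ := hu.exists_forall (Finsupp.single j 1) hε
  have h := h _ (strictMono_add ℓ) (by omega)
  rw [Finsupp.linearCombination_single, one_smul, Function.comp_apply, hx1, abs_sub_comm] at h
  exact h.le

/-- No block sequence of a spreading model of a block basis of `X` has a lower `ℓ₁` estimate. -/
theorem not_lowerEll1_spreading (hx : IsNormalizedBlockBasis (X.e s) x)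
    (hu : IsSpreadingModel x u) {w : ℕ → ℕ →₀ ℝ} (hw : IsBlock w) {c C : ℝ} (hc : 0 < c)
    (hC : ∀ i, ‖Finsupp.linearCombination ℝ u (w i)‖ ≤ C)
    (hl : LowerEll1 (Finsupp.linearCombination ℝ u) c w) : False := by
  obtain ⟨ξ, hξ, hξx, -⟩ := hx.exists_block
  obtain ⟨y, hy, hy1, hyl⟩ :=
    exists_almost_isometric (Finsupp.linearCombination ℝ u) hc hw hC hl
  refine not_almost_isometric_ell1 s
    -- `y i` is realized on the blocks `ξ (t + j)`; for large `t` its norm in `X` is close to that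
    -- in the spreading model. The strict bound `‖y i‖ < 1` and the margin in `199 / 200` absorb the
    -- error.
    (fun i t => Finsupp.linearCombination ℝ (ξ ∘ fun j => t + j) (y i)) ?_ ?_ ?_ ?_
  · intro i j hij t t' htt a ha b hb
    obtain ⟨k, hk, hka⟩ := mem_support_linearCombination ha
    obtain ⟨l, hl, hlb⟩ := mem_support_linearCombination hb
    have := hy i j hij k hk l hl
    exact hξ _ _ (Nat.add_lt_add_of_le_of_lt htt this) a hka b hlb
  · intro i
    obtain ⟨ℓ, h⟩ := hu.exists_forall (y i) (sub_pos.2 (hy1 i))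
    filter_upwards [eventually_ge_atTop ℓ] with t ht
    rw [toX_linearCombination hξx]
    linarith [(abs_lt.1 (h _ (strictMono_add t) (by omega))).2]
  · intro i j hij
    obtain ⟨ℓ, h⟩ := hu.exists_forall (y i + y j) (show (0 : ℝ) < 1 / 100 by norm_num)
    filter_upwards [eventually_ge_atTop ℓ] with t ht t' htt
    set M := (y i).support.sup id + 1
    -- A single increasing sequence that shifts `y i` by `t` and `y j` by `t'`; the jump at `M`
    -- separates the two supports.
    let σ : ℕ → ℕ := fun k => if k < M then t + k else t' + k
    have hσ : StrictMono σ := fun a b hab => by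
      simp only [σ]
      split_ifs <;> omega
    have hi : Finsupp.linearCombination ℝ (ξ ∘ fun j => t + j) (y i) =
        Finsupp.linearCombination ℝ (ξ ∘ σ) (y i) := by
      rw [Finsupp.linearCombination_apply, Finsupp.linearCombination_apply]
      refine Finset.sum_congr rfl fun k hk => ?_
      have : k < M := Nat.lt_succ_of_le (Finset.le_sup (f := id) hk)
      simp [σ, this]
    have hj : Finsupp.linearCombination ℝ (ξ ∘ fun j => t' + j) (y j) =
        Finsupp.linearCombination ℝ (ξ ∘ σ) (y j) := by
      rcases (y i).support.eq_empty_or_nonempty with he | hne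
      · have h0 : y i = 0 := Finsupp.support_eq_empty.1 he
        have := hyl.le_norm_add i i
        rw [h0, add_zero, map_zero, norm_zero] at this
        norm_num at this
      rw [Finsupp.linearCombination_apply, Finsupp.linearCombination_apply]
      refine Finset.sum_congr rfl fun k hk => ?_
      obtain ⟨l, hl, hle⟩ := Finset.exists_mem_eq_sup _ hne id
      have : ¬ k < M := by
        have := hy i j hij l hl k hk
        simp only [M, hle, id]
        omega
      simp [σ, this]
    have h0 : ℓ ≤ σ 0 := by
      simp only [σ]
      split_ifs <;> omega
    rw [hi, hj, ← map_add, toX_linearCombination hξx]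
    linarith [(abs_lt.1 (h σ hσ h0)).1, hyl.le_norm_add i j]
  · intro m hm
    obtain ⟨ℓ, h⟩ := hu.exists_forall (∑ i ∈ Finset.range m, y (i + 2))
      (show (0 : ℝ) < 1 / 200 by norm_num)
    filter_upwards [eventually_ge_atTop ℓ] with t ht
    rw [← map_sum, toX_linearCombination hξx]
    have hm' : (1 : ℝ) ≤ m := by exact_mod_cast hm
    linarith [(abs_lt.1 (h _ (strictMono_add t) (by omega))).1, hyl.le_norm_sum m]

theorem not_contains_ell1_closedSpan (hx : IsNormalizedBlockBasis (X.e s) x)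
    (hu : IsSpreadingModel x u) : ¬ Contains (closedSpan u) Ell1 := by
  rintro ⟨T, c, hc, hT⟩
  have hcl : ∀ v, (closedSpan u).subtypeL (T v) ∈
      closure (Set.range (Finsupp.linearCombination ℝ u)) := fun v => by
    have h : ((T v : closedSpan u) : F) ∈ closure (Submodule.span ℝ (Set.range u) : Set F) :=
      (T v).2
    rwa [← Finsupp.range_linearCombination, LinearMap.coe_range] at h
  obtain ⟨C, c', w, hc', hw, hC, hl⟩ := exists_block_of_ell1
    (norm_linearCombination_restr_le hx hu) (norm_linearCombination_single hx hu)
    ((closedSpan u).subtypeL ∘L T) hcl hc hT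
  exact not_lowerEll1_spreading hx hu hw hc' hC hl

end Spreading

/-! ### Reflexivity -/

/-- Each new index is chosen beyond the support of the vector selected before. -/
lemma exists_isBlock_comp {y : ℕ → ℕ →₀ ℝ} (hy : ∀ N, ∀ i < N, y N i = 0) :
    ∃ φ : ℕ → ℕ, IsBlock (y ∘ φ) := by
  let φ : ℕ → ℕ := fun k => Nat.rec 0 (fun _ M => max M ((y M).support.sup id + 1)) k
  have hφ : ∀ k, φ (k + 1) = max (φ k) ((y (φ k)).support.sup id + 1) := fun k => rfl
  have hm : Monotone φ := monotone_nat_of_le_succ fun k => by rw [hφ]; exact le_max_left _ _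
  refine ⟨φ, fun i j hij a ha b hb => ?_⟩
  have h1 : a < φ (i + 1) := by
    rw [hφ]
    exact lt_max_of_lt_right (Nat.lt_succ_of_le (Finset.le_sup (f := id) ha))
  have h2 : φ j ≤ b := by
    by_contra! h
    exact Finsupp.mem_support_iff.1 hb (hy _ b h)
  exact h1.trans_le ((hm hij).trans h2)

/-- The unit vector basis of `X` is shrinking. -/
theorem exists_forall_abs_le (ψ : StrongDual ℝ (X s)) {ε : ℝ} (hε : 0 < ε) :
    ∃ N, ∀ x : ℕ →₀ ℝ, (∀ i < N, x i = 0) → |ψ (toX s x)| ≤ ε * ‖toX s x‖ := by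
  by_contra! hcon
  have hex : ∀ N, ∃ y : ℕ →₀ ℝ, (∀ i < N, y i = 0) ∧ ‖toX s y‖ = 1 ∧ ε ≤ ψ (toX s y) := by
    intro N
    obtain ⟨x, hx0, hx⟩ := hcon N
    have hne : ‖toX s x‖ ≠ 0 := fun h => by
      rw [norm_eq_zero.1 h, map_zero, abs_zero, norm_zero, mul_zero] at hx
      exact hx.false
    have hpos : 0 < ‖toX s x‖ := (norm_nonneg _).lt_of_ne' hne
    have h2 : ε ≤ ‖toX s x‖⁻¹ * |ψ (toX s x)| := by
      rw [le_inv_mul_iff₀ hpos, mul_comm]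
      exact hx.le
    rcases abs_choice (ψ (toX s x)) with h | h
    · refine ⟨‖toX s x‖⁻¹ • x, fun i hi => by simp [hx0 i hi], ?_, ?_⟩
      · rw [map_smul, norm_smul, norm_inv, norm_norm, inv_mul_cancel₀ hne]
      · rwa [map_smul, map_smul, smul_eq_mul, ← h]
    · refine ⟨-(‖toX s x‖⁻¹ • x), fun i hi => by simp [hx0 i hi], ?_, ?_⟩
      · rw [map_neg, norm_neg, map_smul, norm_smul, norm_inv, norm_norm, inv_mul_cancel₀ hne]
      · rwa [map_neg, map_neg, map_smul, map_smul, smul_eq_mul, ← mul_neg, ← h]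
  choose y hy0 hy1 hyψ using hex
  obtain ⟨φ, hφ⟩ := exists_isBlock_comp hy0
  -- A functional at least `ε` on every block forces a lower ℓ₁ estimate for nonnegative
  -- coefficients, which is all that `LowerEll1` asks.
  refine not_lowerEll1 s hφ (c := ε / (‖ψ‖ + 1)) (by positivity) (fun i => (hy1 (φ i)).le)
    fun b hb => ?_
  set v := Finsupp.linearCombination ℝ (y ∘ φ) b with hv
  have h1 : ε * b.sum (fun _ r => r) ≤ ψ (toX s v) := by
    rw [hv, Finsupp.linearCombination_apply, Finsupp.sum, Finsupp.sum, Finset.mul_sum, map_sum,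
      map_sum]
    refine Finset.sum_le_sum fun i _ => ?_
    rw [map_smul, map_smul, smul_eq_mul, mul_comm]
    exact mul_le_mul_of_nonneg_left (hyψ _) (hb i)
  have h2 : ψ (toX s v) ≤ ‖ψ‖ * ‖toX s v‖ := (le_abs_self _).trans (ψ.le_opNorm _)
  rw [div_mul_eq_mul_div, div_le_iff₀ (by positivity)]
  nlinarith [norm_nonneg (toX s v)]

/-- The initial segments of a sequence. -/
def initSeg (a : ℕ → ℝ) (N : ℕ) : ℕ →₀ ℝ := ∑ i ∈ Finset.range N, Finsupp.single i (a i)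

lemma initSeg_apply (a : ℕ → ℝ) (N i : ℕ) : initSeg a N i = if i < N then a i else 0 := by
  rw [initSeg, Finsupp.finsetSum_apply]
  simp [Finsupp.single_apply]

/-- The unit vector basis of `X` is boundedly complete. -/
theorem cauchySeq_initSeg {a : ℕ → ℝ} {C : ℝ} (hC : ∀ N, ‖toX s (initSeg a N)‖ ≤ C) :
    CauchySeq fun N => toX s (initSeg a N) := by
  rw [Metric.cauchySeq_iff']
  by_contra! hcon
  obtain ⟨ε, hε, hcon⟩ := hcon
  choose n hn hnε using hcon
  let y : ℕ → ℕ →₀ ℝ := fun N => initSeg a (n N) - initSeg a N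
  have hya : ∀ N i, y N i ≠ 0 → y N i = a i := fun N i h => by
    simp only [y, Finsupp.sub_apply, initSeg_apply] at h ⊢
    have := hn N
    by_cases h1 : i < N
    · simp [h1, h1.trans_le this] at h
    · by_cases h2 : i < n N
      · simp [h1, h2]
      · simp [h1, h2] at h
  obtain ⟨φ, hφ⟩ := exists_isBlock_comp (y := y) fun N i hi => by
    simp [y, initSeg_apply, hi, hi.trans_le (hn N)]
  refine not_bounded_sums s hφ hε (fun i => ?_) (C := C) fun m => ?_
  · have := hnε (φ i)
    rwa [dist_eq_norm, ← map_sub] at this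
  · set z := ∑ i ∈ Finset.range m, (y ∘ φ) i with hz
    have hza : ∀ i ∈ z.support, z i = a i := fun i hi => by
      have hi' := Finsupp.mem_support_iff.1 hi
      obtain ⟨k, hk, hki⟩ : ∃ k ∈ Finset.range m, (y ∘ φ) k i ≠ 0 := by
        by_contra! h
        exact hi' (by rw [hz, Finsupp.finsetSum_apply, Finset.sum_eq_zero h])
      rw [hz, hφ.sum_apply hk hki]
      exact hya _ _ hki
    -- The sum of the separated pieces is a restriction of an initial segment, hence bounded by `C`.
    have hzr : z = restr z.support (initSeg a (z.support.sup id + 1)) := by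
      ext i
      rw [restr_apply]
      by_cases hi : i ∈ z.support
      · have : i < z.support.sup id + 1 := Nat.lt_succ_of_le (Finset.le_sup (f := id) hi)
        rw [if_pos hi, hza i hi, initSeg_apply, if_pos this]
      · rw [if_neg hi, Finsupp.notMem_support_iff.1 hi]
    rw [hzr]
    exact (norm_toX_restr_le s _ _).trans (hC _)

/-! ### Duality: coordinate functionals, basis projections and the bidual. -/

/-- The coordinate functionals. -/
def coord (i : ℕ) : StrongDual ℝ (X s) :=
  (Finsupp.lapply i : (ℕ →₀ ℝ) →ₗ[ℝ] ℝ).extendOfNorm (toX s)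

lemma coord_toX (i : ℕ) (x : ℕ →₀ ℝ) : coord s i (toX s x) = x i :=
  LinearMap.extendOfNorm_eq (denseRange_toX s)
    ⟨1, fun x => by rw [one_mul]; exact abs_apply_le_norm_toX s x i⟩ x

/-- The basis projections. -/
def proj (N : ℕ) : X s →L[ℝ] X s := ∑ i ∈ Finset.range N, (coord s i).smulRight (X.e s i)

lemma proj_toX (N : ℕ) (x : ℕ →₀ ℝ) :
    proj s N (toX s x) = toX s (restr (Finset.range N) x) := by
  have : restr (Finset.range N) x = ∑ i ∈ Finset.range N, Finsupp.single i (x i) := by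
    ext i
    rw [restr_apply, Finsupp.finsetSum_apply]
    simp [Finsupp.single_apply]
  simp [proj, this, coord_toX, toX_single]

lemma norm_proj_apply_le (N : ℕ) (v : X s) : ‖proj s N v‖ ≤ ‖v‖ := by
  refine (denseRange_toX s).induction_on v
    (isClosed_le (proj s N).continuous.norm continuous_norm) fun x => ?_
  rw [proj_toX]
  exact norm_toX_restr_le s _ _

lemma norm_comp_proj_le (ψ : StrongDual ℝ (X s)) (N : ℕ) : ‖ψ ∘L proj s N‖ ≤ ‖ψ‖ :=
  ContinuousLinearMap.opNorm_le_bound _ (norm_nonneg _) fun v =>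
    (ψ.le_opNorm _).trans (by gcongr; exact norm_proj_apply_le s N v)

lemma comp_proj_eq (ψ : StrongDual ℝ (X s)) (N : ℕ) :
    ψ ∘L proj s N = ∑ i ∈ Finset.range N, ψ (X.e s i) • coord s i := by
  ext v
  simp [proj, mul_comm]

/-- Shrinking, restated: `ψ` is small in norm on far tails, so the coordinate functionals span a
dense subspace of the dual. -/
lemma tendsto_comp_proj (ψ : StrongDual ℝ (X s)) :
    Tendsto (fun N => ψ ∘L proj s N) atTop (𝓝 ψ) := by
  rw [Metric.tendsto_atTop]
  intro ε hε
  obtain ⟨N, hN⟩ := exists_forall_abs_le s ψ (ε := ε / 4) (by positivity)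
  refine ⟨N, fun n hn => ?_⟩
  rw [dist_eq_norm]
  refine lt_of_le_of_lt (ContinuousLinearMap.opNorm_le_bound _ (half_pos hε).le fun v => ?_)
    (half_lt_self hε)
  refine (denseRange_toX s).induction_on v (isClosed_le
    (ψ ∘L proj s n - ψ).continuous.norm (continuous_const.mul continuous_norm)) fun x => ?_
  have h1 := hN (restr (Finset.range n) x - x) fun i hi => by
    rw [Finsupp.sub_apply, restr_apply, if_pos (Finset.mem_range.2 (hi.trans_le hn)), sub_self]
  rw [map_sub, map_sub] at h1
  have h2 := norm_sub_le (toX s (restr (Finset.range n) x)) (toX s x)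
  have h3 := norm_toX_restr_le s (Finset.range n) x
  rw [sub_apply, ContinuousLinearMap.comp_apply, proj_toX, Real.norm_eq_abs]
  nlinarith

/-- The values of `Φ` on the coordinate functionals are the coordinates of the preimage: bounded
completeness sums the series, and shrinking shows that `Φ` is determined by these values. -/
theorem isReflexive : IsReflexive (X s) := by
  intro Φ
  set a : ℕ → ℝ := fun i => Φ (coord s i) with ha
  have hψ : ∀ (ψ : StrongDual ℝ (X s)) N, ψ (toX s (initSeg a N)) = Φ (ψ ∘L proj s N) := by
    intro ψ N
    rw [comp_proj_eq, initSeg]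
    simp [toX_single, ha, mul_comm]
  have hC : ∀ N, ‖toX s (initSeg a N)‖ ≤ ‖Φ‖ := fun N =>
    NormedSpace.norm_le_dual_bound ℝ _ Φ.opNorm_nonneg fun ψ => by
      rw [hψ]
      exact (Φ.le_opNorm _).trans (by gcongr; exact norm_comp_proj_le s ψ N)
  obtain ⟨x, hx⟩ := cauchySeq_tendsto_of_complete (cauchySeq_initSeg s hC)
  refine ⟨x, ContinuousLinearMap.ext fun ψ => ?_⟩
  rw [NormedSpace.dual_def]
  refine tendsto_nhds_unique ((ψ.continuous.tendsto x).comp hx) ?_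
  refine ((Φ.continuous.tendsto ψ).comp (tendsto_comp_proj s ψ)).congr fun N => ?_
  exact (hψ ψ N).symm

end OdellSchlumprecht

end

theorem theorem1p3 (s : SparseSeq) :
    (∀ (F : Type*) [NormedAddCommGroup F] [NormedSpace ℝ F] [CompleteSpace F]
      (x : ℕ → X s) (u : ℕ → F),
      IsNormalizedBlockBasis (X.e s) x → IsSpreadingModel x u →
        ¬ Contains (closedSpan u) Ell1) ∧
    ¬ Contains (X s) Ell1 ∧ ¬ Contains (X s) CZero ∧ IsReflexive (X s) := by
  exact ⟨fun F _ _ _ x u hx hu => not_contains_ell1_closedSpan hx hu, not_contains_ell1 s,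
    not_contains_czero s, isReflexive s⟩
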